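/- **Setting.** Let $s\ge 1$, $[s]=\{1,\dots,s\}$, and let $[\boldsymbol a,\boldsymbol b]=\prod_{j=1}^s[a_j,b_j]\subset\mathbb R^s$ with $a_j<b_j$. In each direction $j$ let a grid $a_j=y^{(j)}_0<y^{(j)}_1<\dots<y^{(j)}_{K_j}=b_j$ with $K_j\ge 1$ be given, put $\mathcal K=\prod_j\{0,\dots,K_j\}$, $\mathcal K^*=\prod_j\{0,\dots,K_j-1\}$, $\boldsymbol y_{\boldsymbol k}=(y^{(1)}_{k_1},\dots,y^{(s)}_{k_s})$ for $\boldsymbol k\in\mathcal K$, and for $\boldsymbol k\in\mathcal K^*$ let $R_{\boldsymbol k}=\prod_j[y^{(j)}_{k_j},y^{(j)}_{k_j+1})$, $\mathrm{vol}(R_{\boldsymbol k})=\prod_j(y^{(j)}_{k_j+1}-y^{(j)}_{k_j})$ and $\mathrm{diam}(R_{\boldsymbol k})=\big(\sum_j(y^{(j)}_{k_j+1}-y^{(j)}_{k_j})^2\big)^{1/2}$. *Norm.* Let $\gamma_{\mathfrak u}>0$ ($\mathfrak u\subseteq[s]$) be weights with $\gamma_\emptyset\le 1$. For a function $f$ on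 $[\boldsymbol a,\boldsymbol b]$ whose mixed partial derivatives of order at most one in each variable exist on $[\boldsymbol a,\boldsymbol b]$ let $$\|f\|_{p,s,\boldsymbol\gamma}=\Big(\sum_{\mathfrak u\subseteq[s]}\Big(\frac1{\gamma_{\mathfrak u}}\sup_{\boldsymbol x\in[\boldsymbol a,\boldsymbol b]}\Big|\frac{\partial^{|\mathfrak u|}f}{\partial\boldsymbol x_{\mathfrak u}}(\boldsymbol x)\Big|\Big)^p\Big)^{1/p},\qquad G_{\boldsymbol\gamma,q,\boldsymbol a,\boldsymbol b}(N)=\Big(\sum_{\emptyset\ne\mathfrak u\subseteq[s]}\Big(\gamma_{\mathfrak u}\prod_{j\in\mathfrak u}(3(b_j-a_j)\log N)\Big)^q\Big)^{1/q},$$ with maxima instead of sums for exponent $\infty$. *Hat functions.* Let $h_{k,j}$ be the piecewise linear function on $[a_j,b_j]$ with nodes $y^{(j)}_0,\dots,y^{(j)}_{K_j}$ that is $1$ at $y^{(j)}_k$ and $0$ at all the other nodes. Let $c^{(j)}_0=2/(y^{(j)}_1-a_j)$, $c^{(j)}_{K_j}=2/(b_j-y^{(j)}_{K_j-1})$ and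 $c^{(j)}_k=2/(y^{(j)}_{k+1}-y^{(j)}_{k-1})$ for $0<k<K_j$, so that $c^{(j)}_kh_{k,j}$ is a probability density. Let $\Phi_{j,k}(x)=\int_{a_j}^xc^{(j)}_kh_{k,j}$ and let $\Phi_{j,k}^{-1}:[0,1]\to[a_j,b_j]$ be any function with $\Phi_{j,k}(\Phi_{j,k}^{-1}(\tau))=\tau$ for all $\tau$; for $\boldsymbol k\in\mathcal K$ let $\Phi_{\boldsymbol k}^{-1}(\boldsymbol x)=(\Phi_{1,k_1}^{-1}(x_1),\dots,\Phi_{s,k_s}^{-1}(x_s))$. *Algorithm.* Let $\pi:[\boldsymbol a,\boldsymbol b]\to[0,\infty)$ be an unnormalized density with $z=\int_{[\boldsymbol a,\boldsymbol b]}\pi(\boldsymbol x)\,d\boldsymbol x\in(0,\infty)$, and let $\overline\pi=\pi/z$. Put $c_{\boldsymbol k}=\big(\prod_jc^{(j)}_{k_j}\big)^{-1}\pi(\boldsymbol y_{\boldsymbol k})$ and assume $c=\sum_{\boldsymbol k\in\mathcal K}c_{\boldsymbol k}>0$. Let $N\ge 2$ be an integer and $0<\delta<N$. Enumerate $\mathcal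 K$ as $\boldsymbol k_1,\boldsymbol k_2,\dots$ with $c_{\boldsymbol k_1}\ge c_{\boldsymbol k_2}\ge\cdots$ (ties are broken arbitrarily), let $r$ be the smallest number with $\sum_{v=1}^rc_{\boldsymbol k_v}/c\ge1-\delta/N$, and let $\mathcal L_\delta=\{\boldsymbol k_1,\dots,\boldsymbol k_r\}$, $N_{\boldsymbol k_v}=\lfloor Nc_{\boldsymbol k_v}/c\rfloor$ for $v<r$ and $N_{\boldsymbol k_r}=N-\sum_{v<r}N_{\boldsymbol k_v}$. Let $(\boldsymbol y_n)_{n\ge0}$ be a digital $(t,s)$-sequence over $\mathbb F_2$ with non-singular upper triangular generating matrices $C_1,\dots,C_s$, and put $$\mathcal A_{N,s}(f)=\frac1c\sum_{\boldsymbol k\in\mathcal L_\delta}\frac{c_{\boldsymbol k}}{N_{\boldsymbol k}}\sum_{n=0}^{N_{\boldsymbol k}-1}f(\Phi_{\boldsymbol k}^{-1}(\boldsymbol y_n)),$$ where terms with $N_{\boldsymbol k}=0$ are zero. **Theorem.** Let $1\le p,q\le\infty$ with $1/p+1/q=1$. Assume that $\overline\pi$ is bounded and that, for some $\beta\in(0,1]$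 and constants $L_{\overline\pi}(\boldsymbol k)$, $$|\overline\pi(\boldsymbol x)-\overline\pi(\boldsymbol y)|\le L_{\overline\pi}(\boldsymbol k)\,\|\boldsymbol x-\boldsymbol y\|_2^\beta\qquad\text{for all }\boldsymbol x,\boldsymbol y\in\overline{R_{\boldsymbol k}}\text{ and all }\boldsymbol k\in\mathcal K^*,$$ where $\overline{R_{\boldsymbol k}}$ is the closure of $R_{\boldsymbol k}$. Let $f:[\boldsymbol a,\boldsymbol b]\to\mathbb R$ satisfy $\|f\|_{p,s,\boldsymbol\gamma}<\infty$. Then $$\Big|\int_{[\boldsymbol a,\boldsymbol b]}f(\boldsymbol x)\overline\pi(\boldsymbol x)\,d\boldsymbol x-\mathcal A_{N,s}(f)\Big|\le2\|f\|_{L_\infty}\sum_{\boldsymbol k\in\mathcal K^*}\mathrm{vol}(R_{\boldsymbol k})\,L_{\overline\pi}(\boldsymbol k)\,\mathrm{diam}(R_{\boldsymbol k})^\beta+\|f\|_{p,s,\boldsymbol\gamma}\,\frac{\delta+3r-2}{N}\Big[1+5\cdot2^t\log(2N)\,G_{\boldsymbol\gamma,q,\boldsymbol a,\boldsymbol b}(N)\Big].$$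 -/

import Mathlib

open MeasureTheory
open scoped ENNReal

noncomputable section

namespace HatQMC

/-! ### Weighted norms of mixed partial derivatives -/

/-- The `ℓ^p` aggregate of a finite family in `[0, ∞]`, for `p ∈ [1, ∞]`
(a maximum when `p = ∞`). -/
def lpAgg {ι : Type*} (p : ℝ≥0∞) (I : Finset ι) (v : ι → ℝ≥0∞) : ℝ≥0∞ :=
  if p = ∞ then I.sup v else (∑ i ∈ I, v i ^ p.toReal) ^ (1 / p.toReal)

/-- The partial derivative in direction `j` of a function on the box `[a, b]`
(one-sided at the faces of the box). -/
def partialDeriv {s : ℕ} (a b : Fin s → ℝ) (j : Fin s) (g : (Fin s → ℝ) → ℝ)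
    (x : Fin s → ℝ) : ℝ :=
  derivWithin (fun τ => g (Function.update x j τ)) (Set.Icc (a j) (b j)) (x j)

/-- The mixed partial derivative `∂^{|u|} f / ∂x_{u_1} ⋯ ∂x_{u_k}`, where
`u = {u_1 < ⋯ < u_k}`; the derivative in direction `u_k` is taken first. -/
def mixedPartial {s : ℕ} (a b : Fin s → ℝ) (u : Finset (Fin s)) (f : (Fin s → ℝ) → ℝ) :
    (Fin s → ℝ) → ℝ :=
  (u.sort (· ≤ ·)).foldr (partialDeriv a b) f

/-- All mixed partial derivatives of `f` of order at most one in each variable exist at every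
point of `[a, b]`. -/
def HasMixedPartials {s : ℕ} (a b : Fin s → ℝ) (f : (Fin s → ℝ) → ℝ) : Prop :=
  ∀ (u : Finset (Fin s)) (j : Fin s), (∀ i ∈ u, j < i) → ∀ x ∈ Set.Icc a b,
    DifferentiableWithinAt ℝ (fun τ => mixedPartial a b u f (Function.update x j τ))
      (Set.Icc (a j) (b j)) (x j)

/-- The `γ`-weighted `p`-norm on `[a, b]`, with values in `[0, ∞]`. -/
def weightedNorm {s : ℕ} (p : ℝ≥0∞) (γ : Finset (Fin s) → ℝ) (a b : Fin s → ℝ)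
    (f : (Fin s → ℝ) → ℝ) : ℝ≥0∞ :=
  lpAgg p Finset.univ fun u =>
    ENNReal.ofReal (1 / γ u) * ⨆ x ∈ Set.Icc a b, ENNReal.ofReal |mixedPartial a b u f x|

/-- The quantity `G_{γ,q,a,b}(N)`. -/
def gFactor {s : ℕ} (γ : Finset (Fin s) → ℝ) (q : ℝ≥0∞) (a b : Fin s → ℝ) (N : ℕ) : ℝ :=
  (lpAgg q (Finset.univ.filter fun u : Finset (Fin s) => u.Nonempty) fun u =>
    ENNReal.ofReal (γ u * ∏ j ∈ u, (3 * (b j - a j) * Real.log N))).toReal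

/-! ### Digital nets and sequences over the field with two elements -/

/-- The matrices `C_1, …, C_s` generate a digital `(t, m, s)`-net over `𝔽₂`. -/
def GeneratesDigitalNet {s : ℕ} (t m : ℕ) (C : Fin s → Matrix (Fin m) (Fin m) (ZMod 2)) : Prop :=
  t ≤ m ∧ ∀ d : Fin s → ℕ, ∑ j, d j = m - t →
    LinearIndependent (ZMod 2)
      fun i : (Σ j : Fin s, {l : Fin m // (l : ℕ) < d j}) => C i.1 i.2.1

/-- The infinite matrices `C_1, …, C_s` generate a digital `(t, s)`-sequence over `𝔽₂`
(rows and columns are numbered from `0`). -/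
def GeneratesDigitalSequence {s : ℕ} (t : ℕ) (C : Fin s → Matrix ℕ ℕ (ZMod 2)) : Prop :=
  (∀ j l, ∃ R, ∀ k, R < k → C j k l = 0) ∧
    ∀ m, 1 ≤ m → t ≤ m →
      GeneratesDigitalNet t m fun j => (C j).submatrix (Fin.val : Fin m → ℕ) (Fin.val : Fin m → ℕ)

/-- A non-singular upper triangular infinite matrix. -/
def IsNonsingularUpperTriangular (C : Matrix ℕ ℕ (ZMod 2)) : Prop :=
  (∀ k l, l < k → C k l = 0) ∧ ∀ k, C k k ≠ 0

/-- The `k`-th entry of the product of `C` with the vector of binary digits of `n`. -/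
def digitalDigit (C : Matrix ℕ ℕ (ZMod 2)) (n k : ℕ) : ZMod 2 :=
  ∑ l ∈ Finset.range n.size, C k l * ((n / 2 ^ l : ℕ) : ZMod 2)

/-- The `n`-th point of the digital sequence generated by `C_1, …, C_s`. -/
def digitalPoint {s : ℕ} (C : Fin s → Matrix ℕ ℕ (ZMod 2)) (n : ℕ) : Fin s → ℝ :=
  fun j => ∑' k : ℕ, ((digitalDigit (C j) n k).val : ℝ) / 2 ^ (k + 1)

/-! ### The quasi-Monte Carlo algorithm for mixtures

A mixture has nonnegative coefficients `c k`, where `k` runs over a finite set of indices;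
`σ` lists the indices. -/

/-- The least `r` for which the first `r` normalized coefficients sum up to at least
`1 - δ / N`. -/
def truncLevel {κ : Type*} [Fintype κ] (c : κ → ℝ) (σ : Fin (Fintype.card κ) ≃ κ) (δ : ℝ)
    (N : ℕ) : ℕ :=
  sInf {r : ℕ | 1 - δ / N ≤
    ∑ v ∈ Finset.univ.filter (fun v : Fin (Fintype.card κ) => (v : ℕ) < r),
      c (σ v) / ∑ l, c l}

/-- The set of the first `r` indices. -/
def retained {κ : Type*} [Fintype κ] (c : κ → ℝ) (σ : Fin (Fintype.card κ) ≃ κ) (δ : ℝ)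
    (N : ℕ) : Finset κ :=
  Finset.univ.filter fun k => (σ.symm k : ℕ) < truncLevel c σ δ N

/-- The number of points used for the retained index `k`: it is `⌊N c_k / c⌋` for the first
`r - 1` indices, and the `r`-th index receives the remaining points. -/
def sampleSize {κ : Type*} [Fintype κ] (c : κ → ℝ) (σ : Fin (Fintype.card κ) ≃ κ) (δ : ℝ)
    (N : ℕ) (k : κ) : ℕ :=
  if (σ.symm k : ℕ) + 1 < truncLevel c σ δ N then ⌊N * c k / ∑ l, c l⌋₊
  else N - ∑ i ∈ Finset.univ.filter (fun i => (σ.symm i : ℕ) + 1 < truncLevel c σ δ N),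
    ⌊N * c i / ∑ l, c l⌋₊

/-- The algorithm for mixtures: `T k` transforms points of the unit cube into points distributed
like the `k`-th component, and `y` is the sequence of points in the unit cube. A retained index
with sample size zero contributes zero. -/
def mixtureQMC {s : ℕ} {κ : Type*} [Fintype κ] (c : κ → ℝ) (σ : Fin (Fintype.card κ) ≃ κ)
    (δ : ℝ) (N : ℕ) (T : κ → (Fin s → ℝ) → (Fin s → ℝ)) (y : ℕ → Fin s → ℝ)
    (f : (Fin s → ℝ) → ℝ) : ℝ :=
  1 / (∑ l, c l) * ∑ k ∈ retained c σ δ N,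
    c k / (sampleSize c σ δ N k : ℝ) * ∑ n ∈ Finset.range (sampleSize c σ δ N k), f (T k (y n))

/-! ### Tensor grids and hat functions -/

/-- A tensor grid on `[a, b]`: in direction `j` the nodes are
`a_j = y_0 < y_1 < ⋯ < y_{K_j} = b_j` (the values `node j k` for `k > K j` play no role). -/
structure TensorGrid {s : ℕ} (a b : Fin s → ℝ) where
  /-- the number of cells in each direction -/
  K : Fin s → ℕ
  /-- the nodes in each direction -/
  node : Fin s → ℕ → ℝ
  K_pos : ∀ j, 1 ≤ K j
  node_zero : ∀ j, node j 0 = a j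
  node_last : ∀ j, node j (K j) = b j
  node_lt : ∀ j, ∀ k < K j, node j k < node j (k + 1)

/-- The Euclidean diameter of the interval with opposite vertices `x` and `y`. -/
def boxDiam {s : ℕ} (x y : Fin s → ℝ) : ℝ := Real.sqrt (∑ j, (y j - x j) ^ 2)

namespace TensorGrid

variable {s : ℕ} {a b : Fin s → ℝ} (𝒢 : TensorGrid a b)

/-- The indices of the grid points. -/
abbrev Index : Type := ∀ j, Fin (𝒢.K j + 1)

/-- The indices of the cells. -/
abbrev CellIndex : Type := ∀ j, Fin (𝒢.K j)

/-- The grid point with index `k`. -/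
def point (k : 𝒢.Index) : Fin s → ℝ := fun j => 𝒢.node j (k j)

/-- The lower vertex of the cell with index `k`. -/
def lower (k : 𝒢.CellIndex) : Fin s → ℝ := fun j => 𝒢.node j (k j)

/-- The upper vertex of the cell with index `k`. -/
def upper (k : 𝒢.CellIndex) : Fin s → ℝ := fun j => 𝒢.node j (k j + 1)

/-- The volume of the cell with index `k`. -/
def cellVol (k : 𝒢.CellIndex) : ℝ := ∏ j, (𝒢.upper k j - 𝒢.lower k j)

/-- The Euclidean diameter of the cell with index `k`. -/
def cellDiam (k : 𝒢.CellIndex) : ℝ := boxDiam (𝒢.lower k) (𝒢.upper k)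

/-- The one-dimensional hat function in direction `j` with peak at the `k`-th node. -/
def hat (j : Fin s) (k : ℕ) (x : ℝ) : ℝ :=
  if 1 ≤ k ∧ 𝒢.node j (k - 1) ≤ x ∧ x ≤ 𝒢.node j k then
    (x - 𝒢.node j (k - 1)) / (𝒢.node j k - 𝒢.node j (k - 1))
  else if k + 1 ≤ 𝒢.K j ∧ 𝒢.node j k ≤ x ∧ x ≤ 𝒢.node j (k + 1) then
    (𝒢.node j (k + 1) - x) / (𝒢.node j (k + 1) - 𝒢.node j k)
  else 0

/-- The constant that turns the `k`-th hat function in direction `j` into a probability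
density. -/
def hatConst (j : Fin s) (k : ℕ) : ℝ :=
  if k = 0 then 2 / (𝒢.node j 1 - a j)
  else if k = 𝒢.K j then 2 / (b j - 𝒢.node j (𝒢.K j - 1))
  else 2 / (𝒢.node j (k + 1) - 𝒢.node j (k - 1))

/-- The cumulative distribution function of the `k`-th normalized hat function in
direction `j`. -/
def hatCDF (j : Fin s) (k : ℕ) (x : ℝ) : ℝ :=
  ∫ τ in (a j)..x, 𝒢.hatConst j k * 𝒢.hat j k τ

/-- `Q` inverts the cumulative distribution functions of all the normalized hat functions:
`Q j k` maps `[0, 1]` to `[a_j, b_j]` and is a right inverse of the `k`-th distribution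
function in direction `j`. The value is determined by this, except at the arguments `0` and `1`
(where the distribution function may be constant near an end of `[a_j, b_j]`). -/
def IsInverseCDF (Q : Fin s → ℕ → ℝ → ℝ) : Prop :=
  ∀ j, ∀ k ≤ 𝒢.K j, ∀ τ ∈ Set.Icc (0 : ℝ) 1,
    Q j k τ ∈ Set.Icc (a j) (b j) ∧ 𝒢.hatCDF j k (Q j k τ) = τ

/-- The mixture coefficients of the hat function approximation of `π`. -/
def coeff (π : (Fin s → ℝ) → ℝ) (k : 𝒢.Index) : ℝ :=
  (∏ j, 𝒢.hatConst j (k j))⁻¹ * π (𝒢.point k)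

/-- The algorithm based on the hat function approximation of the density proportional to `π`. -/
def hatQMC (π : (Fin s → ℝ) → ℝ) (σ : Fin (Fintype.card 𝒢.Index) ≃ 𝒢.Index)
    (δ : ℝ) (N : ℕ) (Q : Fin s → ℕ → ℝ → ℝ) (y : ℕ → Fin s → ℝ) (f : (Fin s → ℝ) → ℝ) : ℝ :=
  mixtureQMC (𝒢.coeff π) σ δ N (fun k x j => Q j (k j) (x j)) y f

end TensorGrid

end HatQMC

end

/-! Let `p` be the piecewise multilinear interpolant of `π` at the grid points. Writing each tensor
hat as a constant times a product probability density turns `p / c` into a mixture of product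
distributions with weights `c_k / c`. The integral of `f` against this mixture separates the two
error terms.

Approximation (`TensorGrid.abs_integral_sub_mixture_le`). The hats form a partition of unity, so on
a cell `p` is a convex combination of the values of `π` at the vertices, and the Hölder bound gives
`|π - p| / z ≤ L diam ^ β`. Let `S` be the sum of volume times this bound. Replacing `π / z` by `p /
z` costs `‖f‖ S`. Replacing `p / z` by `p / c` costs another `‖f‖ S`, because `|1 - c / z|` is
itself at most the integral of `|π - p| / z`.

Sampling (`abs_mixture_sub_mixtureQMC_le`). Suppose `R ≤ N` points integrate each component with
error at most `W / R`. The sample sizes are proportional to the weights up to rounding, so weight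
times error is of order `1 / N` for each retained component, and the dropped components have total
weight at most `δ / N`.

One component (`TensorGrid.abs_integral_mixtureMeasure_sub_le`). The inverse distribution functions
act coordinatewise and monotonically, so a box `{x ≤ τ}` pulls back to a box anchored at `0`, up to
its upper faces. The discrepancy relative to the component is thus that of the digital sequence. For
the latter (`abs_discrepancy_le`), independence of matrix rows makes large elementary intervals
exactly equidistributed; anchored boxes are cut into dyadic pieces, and the first `R` indices into
aligned blocks with lengths given by the binary digits of `R`.

Discrepancy is converted into quadrature error by `koksma_hlawka`. It replaces `f` by a step
function on a fine grid whose jumps are mixed differences of `f`, bounded by a mean value inequality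
(`abs_mixedDiff_le`). Hence existence and boundedness of the mixed derivatives suffice. Hölder's
inequality over the subsets `u`, together with `size_le_log`, turns the resulting sum into `‖f‖`
times the factor `G`. -/

namespace HatQMC

/-! ### Elementary intervals and digital nets -/

/-- Linearly independent equations over `𝔽₂` have the expected number of solutions. -/
lemma card_solutions_mul {m : ℕ} {ι : Type*} [Fintype ι] (B : ι → Fin m → ZMod 2)
    (hB : LinearIndependent (ZMod 2) B) (w : ι → ZMod 2) :
    (Finset.univ.filter fun v : Fin m → ZMod 2 => ∀ i, ∑ l, B i l * v l = w i).card
      * 2 ^ Fintype.card ι = 2 ^ m := by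
  classical
  set g : (Fin m → ZMod 2) →ₗ[ZMod 2] (ι → ZMod 2) := Matrix.mulVecLin (Matrix.of B) with hg
  have hgv : ∀ v i, g v i = ∑ l, B i l * v l := fun v i => rfl
  have hrank : (Matrix.of B).rank = Fintype.card ι := LinearIndependent.rank_matrix hB
  have hsurj : LinearMap.range g = ⊤ := by
    apply Submodule.eq_top_of_finrank_eq
    rw [Module.finrank_fintype_fun_eq_card]
    exact hrank
  have hr : ∀ x, x ∈ Set.range g := fun x => by
    have : x ∈ LinearMap.range g := hsurj ▸ Submodule.mem_top
    simpa using this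
  -- The system is a surjective homomorphism, so its `2 ^ card ι` fibres are equally large and
  -- together exhaust `2 ^ m` vectors.
  have hcard := Finset.card_eq_sum_card_fiberwise (f := g) (s := Finset.univ) (t := Finset.univ)
    (fun _ _ => by simp)
  rw [Finset.sum_congr rfl (fun b _ =>
    AddMonoidHom.card_fiber_eq_of_mem_range g (hr b) (hr w))] at hcard
  simp only [Finset.card_univ, Fintype.card_pi, ZMod.card, Finset.prod_const, Fintype.card_fin,
    Finset.sum_const, smul_eq_mul] at hcard
  rw [hcard, mul_comm]
  congr 2
  ext v
  simp [funext_iff, hgv]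

/-- The integer whose binary digits are the first `d` entries of `g`, the first one being the
most significant one. -/
def digitPrefix (g : ℕ → ZMod 2) : ℕ → ℕ
  | 0 => 0
  | d + 1 => 2 * digitPrefix g d + (g d).val

/-- Binary digits are unique, so prescribing a prefix amounts to `d` separate equations over `𝔽₂`.
In this form elementary intervals become linear systems. -/
lemma exists_digitPrefix_eq_iff (d A : ℕ) (hA : A < 2 ^ d) :
    ∃ w : ℕ → ZMod 2, ∀ g : ℕ → ZMod 2, digitPrefix g d = A ↔ ∀ k < d, g k = w k := by
  induction d generalizing A with
  | zero =>
    refine ⟨0, fun g => ?_⟩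
    have : A = 0 := by simpa using hA
    simp [digitPrefix, this]
  | succ d ih =>
    obtain ⟨w, hw⟩ := ih (A / 2) (by rw [pow_succ] at hA; omega)
    refine ⟨fun k => if k < d then w k else (A : ZMod 2), fun g => ?_⟩
    have h1 : digitPrefix g (d + 1) = A ↔ digitPrefix g d = A / 2 ∧ (g d).val = A % 2 := by
      have := ZMod.val_lt (g d)
      simp only [digitPrefix]
      omega
    have h2 : (g d).val = A % 2 ↔ g d = (A : ZMod 2) := by
      rw [← ZMod.val_natCast]
      exact (ZMod.val_injective 2).eq_iff
    rw [h1, hw, h2]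
    constructor
    · rintro ⟨h, h'⟩ k hk
      by_cases hkd : k < d
      · simp [hkd, h k hkd]
      · have : k = d := by omega
        subst this
        simpa using h'
    · intro h
      refine ⟨fun k hk => ?_, ?_⟩
      · simpa [hk] using h k (by omega)
      · simpa using h d (by omega)

lemma summable_digits (g : ℕ → ZMod 2) :
    Summable fun k : ℕ => ((g k).val : ℝ) / 2 ^ (k + 1) := by
  refine Summable.of_nonneg_of_le (fun k => by positivity) (fun k => ?_) summable_geometric_two
  have h : ((g k).val : ℝ) ≤ 1 := by
    have := ZMod.val_lt (g k)
    exact_mod_cast (by omega : (g k).val ≤ 1)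
  calc ((g k).val : ℝ) / 2 ^ (k + 1) ≤ 1 / 2 ^ (k + 1) := by gcongr
    _ ≤ (1 / 2) ^ k := by
      rw [one_div_pow]
      gcongr
      · norm_num
      · omega

lemma tsum_digits_eq (g : ℕ → ZMod 2) :
    ∑' k : ℕ, ((g k).val : ℝ) / 2 ^ (k + 1)
      = ((g 0).val + ∑' k : ℕ, ((g (k + 1)).val : ℝ) / 2 ^ (k + 1)) / 2 := by
  rw [(summable_digits g).tsum_eq_zero_add, add_div, ← tsum_div_const]
  congr 1
  · simp
  · refine tsum_congr fun k => ?_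
    rw [pow_succ _ (k + 1), div_div]

/-- Finitely many nonzero digits exclude an expansion ending in ones, the only way to reach `1`.
Peeling off the first digit gives the induction. -/
lemma tsum_digits_lt_one (g : ℕ → ZMod 2) (K : ℕ) (hK : ∀ k, K ≤ k → g k = 0) :
    ∑' k : ℕ, ((g k).val : ℝ) / 2 ^ (k + 1) < 1 := by
  induction K generalizing g with
  | zero => simp [hK]
  | succ K ih =>
    rw [tsum_digits_eq]
    have h1 := ih (fun k => g (k + 1)) (fun k hk => hK _ (by omega))
    have h : ((g 0).val : ℝ) ≤ 1 := by
      have := ZMod.val_lt (g 0)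
      exact_mod_cast (by omega : (g 0).val ≤ 1)
    linarith

lemma two_pow_mul_tsum_digits (g : ℕ → ZMod 2) (d : ℕ) :
    2 ^ d * ∑' k : ℕ, ((g k).val : ℝ) / 2 ^ (k + 1)
      = digitPrefix g d + ∑' k : ℕ, ((g (k + d)).val : ℝ) / 2 ^ (k + 1) := by
  induction d with
  | zero => simp [digitPrefix]
  | succ d ih =>
    rw [pow_succ', mul_assoc, ih, tsum_digits_eq (fun k => g (k + d))]
    have : ∀ k, k + 1 + d = k + (d + 1) := fun k => by ring
    simp only [digitPrefix, this]
    push_cast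
    simp only [zero_add]
    ring

/-- Scaling by `2 ^ d` moves `d` digits in front of the point and leaves a tail in `[0, 1)`. -/
lemma floor_two_pow_mul_tsum_digits (g : ℕ → ZMod 2) (K : ℕ) (hK : ∀ k, K ≤ k → g k = 0)
    (d : ℕ) :
    ⌊2 ^ d * ∑' k : ℕ, ((g k).val : ℝ) / 2 ^ (k + 1)⌋₊ = digitPrefix g d := by
  rw [two_pow_mul_tsum_digits, Nat.floor_eq_iff (by positivity)]
  refine ⟨le_add_of_nonneg_right (tsum_nonneg fun k => by positivity), ?_⟩
  have := tsum_digits_lt_one (fun k => g (k + d)) K (fun k hk => hK _ (by omega))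
  linarith

/-! ### Digits of the points of a digital sequence -/

lemma digitalDigit_eq_sum (C : Matrix ℕ ℕ (ZMod 2)) (n k M : ℕ) (hM : n < 2 ^ M) :
    digitalDigit C n k = ∑ l ∈ Finset.range M, C k l * ((n / 2 ^ l : ℕ) : ZMod 2) := by
  refine Finset.sum_subset (Finset.range_mono (Nat.size_le.2 hM)) fun l _ hl => ?_
  have : n / 2 ^ l = 0 := Nat.div_eq_of_lt (Nat.size_le.1 (by simpa using hl))
  simp [this]

/-- Triangularity makes every expansion finite, as the floor computation requires. -/
lemma digitalDigit_eq_zero {C : Matrix ℕ ℕ (ZMod 2)} (hC : IsNonsingularUpperTriangular C)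
    (n k : ℕ) (hk : n.size ≤ k) : digitalDigit C n k = 0 :=
  Finset.sum_eq_zero fun l hl => by rw [hC.1 k l (by simp at hl; omega), zero_mul]

lemma digitalPoint_mem_Ico {s : ℕ} {C : Fin s → Matrix ℕ ℕ (ZMod 2)}
    (hC : ∀ j, IsNonsingularUpperTriangular (C j)) (n : ℕ) (j : Fin s) :
    digitalPoint C n j ∈ Set.Ico (0 : ℝ) 1 :=
  ⟨tsum_nonneg fun k => by positivity,
    tsum_digits_lt_one _ n.size fun k hk => digitalDigit_eq_zero (hC j) n k hk⟩

lemma floor_digitalPoint {s : ℕ} {C : Fin s → Matrix ℕ ℕ (ZMod 2)}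
    (hC : ∀ j, IsNonsingularUpperTriangular (C j)) (n : ℕ) (j : Fin s) (d : ℕ) :
    ⌊2 ^ d * digitalPoint C n j⌋₊ = digitPrefix (digitalDigit (C j) n) d :=
  floor_two_pow_mul_tsum_digits _ n.size (fun k hk => digitalDigit_eq_zero (hC j) n k hk) d

/-- On an aligned block of `2 ^ m` indices the digits are affine functions of the low bits. -/
lemma exists_digitalDigit_block (C : Matrix ℕ ℕ (ZMod 2)) (m ℓ k : ℕ) :
    ∃ e : ZMod 2, ∀ n < 2 ^ m, digitalDigit C (ℓ * 2 ^ m + n) k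
      = ∑ l : Fin m, C k l * ((n / 2 ^ (l : ℕ) : ℕ) : ZMod 2) + e := by
  -- The columns from `m` on meet only the digits of `ℓ`, which are constant on the block.
  refine ⟨∑ l ∈ Finset.range ℓ.size, C k (m + l) * ((ℓ / 2 ^ l : ℕ) : ZMod 2), fun n hn => ?_⟩
  have hlt : ℓ * 2 ^ m + n < 2 ^ (m + ℓ.size) := by
    have h1 : ℓ + 1 ≤ 2 ^ ℓ.size := Nat.lt_size_self ℓ
    calc ℓ * 2 ^ m + n < (ℓ + 1) * 2 ^ m := by rw [add_mul]; omega
      _ ≤ 2 ^ ℓ.size * 2 ^ m := Nat.mul_le_mul_right _ h1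
      _ = _ := by rw [pow_add, mul_comm]
  rw [digitalDigit_eq_sum C _ k _ hlt, Finset.sum_range_add]
  congr 1
  · rw [Finset.sum_range]
    refine Finset.sum_congr rfl fun l _ => ?_
    congr 1
    -- Since `l < m`, the number `ℓ * 2 ^ m` is a multiple of `2 ^ (l + 1)` and does not affect
    -- digit `l` modulo 2.
    have h2 : ℓ * 2 ^ m + n = n + 2 ^ (l : ℕ) * (2 * (ℓ * 2 ^ (m - l - 1))) := by
      have : 2 ^ m = 2 ^ (l : ℕ) * (2 * 2 ^ (m - l - 1)) := by
        rw [← pow_succ', ← pow_add]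
        congr 1
        omega
      rw [this]
      ring
    rw [h2, Nat.add_mul_div_left _ _ (by positivity)]
    have h3 : (2 : ZMod 2) = 0 := rfl
    push_cast
    rw [h3]
    simp
  · refine Finset.sum_congr rfl fun l _ => ?_
    congr 2
    rw [pow_add, ← Nat.div_div_eq_div_mul]
    congr 1
    rw [mul_comm, Nat.mul_add_div (by positivity), Nat.div_eq_of_lt hn, add_zero]

/-- The bits of the numbers below `2 ^ m`. -/
lemma card_filter_range_two_pow (m : ℕ) (P : (Fin m → ZMod 2) → Prop) [DecidablePred P] :
    ((Finset.range (2 ^ m)).filter fun n =>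
        P fun l => ((n / 2 ^ (l : ℕ) : ℕ) : ZMod 2)).card
      = (Finset.univ.filter P).card := by
  set E : Fin (2 ^ m) ≃ (Fin m → ZMod 2) := finFunctionFinEquiv.symm with hE
  have hEv : ∀ n : Fin (2 ^ m), E n = fun l : Fin m => (((n : ℕ) / 2 ^ (l : ℕ) : ℕ) : ZMod 2) := by
    intro n
    funext l
    apply ZMod.val_injective
    rw [ZMod.val_natCast]
    rfl
  symm
  refine Finset.card_bij (fun v _ => ((E.symm v : Fin (2 ^ m)) : ℕ)) ?_ ?_ ?_
  · intro v hv
    simp only [Finset.mem_filter, Finset.mem_range, Finset.mem_univ, true_and] at hv ⊢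
    refine ⟨Fin.is_lt _, ?_⟩
    rw [← hEv, Equiv.apply_symm_apply]
    exact hv
  · intro v _ v' _ h
    exact E.symm.injective (Fin.ext h)
  · intro n hn
    simp only [Finset.mem_filter, Finset.mem_range] at hn
    refine ⟨E ⟨n, hn.1⟩, ?_, by simp⟩
    simp only [Finset.mem_filter, Finset.mem_univ, true_and]
    rw [hEv]
    exact hn.2

lemma exists_le_sum_eq {ι : Type*} [Fintype ι] (d : ι → ℕ) (r : ℕ) (h : r ≤ ∑ j, d j) :
    ∃ d' : ι → ℕ, (∀ j, d' j ≤ d j) ∧ ∑ j, d' j = r := by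
  classical
  induction r with
  | zero => exact ⟨0, fun j => Nat.zero_le _, by simp⟩
  | succ r ih =>
    obtain ⟨d', hd, hs⟩ := ih (by omega)
    obtain ⟨j, hj⟩ : ∃ j, d' j < d j := by
      by_contra hcon
      push Not at hcon
      have := Finset.sum_le_sum fun j (_ : j ∈ Finset.univ) => hcon j
      omega
    refine ⟨Function.update d' j (d' j + 1), fun i => ?_, ?_⟩
    · by_cases hi : i = j
      · subst hi; simpa using hj
      · simpa [hi] using hd i
    · rw [Finset.sum_update_of_mem (Finset.mem_univ j), ← hs,
        ← Finset.add_sum_erase _ d' (Finset.mem_univ j), Finset.sdiff_singleton_eq_erase]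
      ring

lemma exists_ge_sum_eq {s : ℕ} (hs : 1 ≤ s) (d : Fin s → ℕ) (r : ℕ) (h : ∑ j, d j ≤ r) :
    ∃ d' : Fin s → ℕ, (∀ j, d j ≤ d' j) ∧ ∑ j, d' j = r := by
  refine ⟨Function.update d ⟨0, hs⟩ (d ⟨0, hs⟩ + (r - ∑ j, d j)), fun i => ?_, ?_⟩
  · by_cases hi : i = ⟨0, hs⟩
    · subst hi; simp
    · simp [hi]
  · rw [Finset.sum_update_of_mem (Finset.mem_univ _), Finset.sdiff_singleton_eq_erase]
    have := Finset.add_sum_erase Finset.univ d (Finset.mem_univ (⟨0, hs⟩ : Fin s))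
    omega

/-- The net property speaks of `∑ d j = m - t` and of `m ≥ 1`. Smaller sums are handled by enlarging
one coordinate, since subfamilies of independent families are independent; for `m = 0` the family is
empty. -/
lemma linearIndependent_rows {s : ℕ} (hs : 1 ≤ s) {t : ℕ} {C : Fin s → Matrix ℕ ℕ (ZMod 2)}
    (hC : GeneratesDigitalSequence t C) {m : ℕ} (htm : t ≤ m) (d : Fin s → ℕ)
    (hd : ∑ j, d j ≤ m - t) :
    LinearIndependent (ZMod 2)
      fun i : (Σ j : Fin s, {l : Fin m // (l : ℕ) < d j}) => fun l : Fin m =>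
        C i.1 (i.2.1 : ℕ) (l : ℕ) := by
  rcases Nat.eq_zero_or_pos m with rfl | hm
  · have : IsEmpty (Σ j : Fin s, {l : Fin 0 // (l : ℕ) < d j}) :=
      ⟨fun i => i.2.1.elim0⟩
    exact linearIndependent_empty_type
  · obtain ⟨d', hdd, hs'⟩ := exists_ge_sum_eq hs d _ hd
    have h := ((hC.2 m hm htm).2 d' hs').comp
      (fun i : (Σ j : Fin s, {l : Fin m // (l : ℕ) < d j}) =>
        (⟨i.1, ⟨i.2.1, i.2.2.trans_le (hdd _)⟩⟩ : Σ j : Fin s, {l : Fin m // (l : ℕ) < d' j}))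
      (by
        rintro ⟨j, l, hl⟩ ⟨j', l', hl'⟩ h
        simp only [Sigma.mk.injEq] at h
        obtain ⟨rfl, h⟩ := h
        simpa using h)
    exact h

lemma card_sigma_rows {s : ℕ} (m : ℕ) (d : Fin s → ℕ) (hd : ∀ j, d j ≤ m) :
    Fintype.card (Σ j : Fin s, {l : Fin m // (l : ℕ) < d j}) = ∑ j, d j := by
  rw [Fintype.card_sigma]
  refine Finset.sum_congr rfl fun j _ => ?_
  rw [Fintype.card_subtype, ← Finset.card_map Fin.valEmbedding]
  have : (Finset.univ.filter fun l : Fin m => (l : ℕ) < d j).map Fin.valEmbedding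
      = Finset.range (d j) := by
    ext l
    simp only [Finset.mem_map, Finset.mem_filter, Finset.mem_univ, true_and,
      Fin.valEmbedding_apply, Finset.mem_range]
    exact ⟨fun ⟨a, h, e⟩ => e ▸ h, fun h => ⟨⟨l, h.trans_le (hd j)⟩, h, rfl⟩⟩
  rw [this, Finset.card_range]

/-- An elementary interval of volume at least `2 ^ (t - m)` contains the expected number of
points of an aligned block of length `2 ^ m` of a digital `(t, s)`-sequence. -/
lemma card_elementary_mul {s : ℕ} (hs : 1 ≤ s) {t : ℕ} {C : Fin s → Matrix ℕ ℕ (ZMod 2)}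
    (hC : GeneratesDigitalSequence t C) (hCt : ∀ j, IsNonsingularUpperTriangular (C j))
    {m : ℕ} (htm : t ≤ m) (ℓ : ℕ) (d A : Fin s → ℕ)
    (hd : ∑ j, d j ≤ m - t) (hA : ∀ j, A j < 2 ^ d j) :
    ((Finset.range (2 ^ m)).filter fun n =>
      ∀ j, ⌊2 ^ d j * digitalPoint C (ℓ * 2 ^ m + n) j⌋₊ = A j).card * 2 ^ (∑ j, d j)
        = 2 ^ m := by
  classical
  have hdm : ∀ j, d j ≤ m := fun j =>
    (Finset.single_le_sum (fun i _ => Nat.zero_le _) (Finset.mem_univ j)).trans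
      (hd.trans (Nat.sub_le _ _))
  choose w hw using fun j => exists_digitPrefix_eq_iff (d j) (A j) (hA j)
  choose e he using fun (j : Fin s) (k : ℕ) => exists_digitalDigit_block (C j) m ℓ k
  -- Moving the block constants `e` to the right-hand side makes the floor conditions a system with
  -- these independent rows.
  have key := card_solutions_mul _ (linearIndependent_rows hs hC htm d hd)
    (fun i => w i.1 (i.2.1 : ℕ) - e i.1 (i.2.1 : ℕ))
  rw [card_sigma_rows m d hdm, ← card_filter_range_two_pow m (fun v =>
    ∀ i : (Σ j : Fin s, {l : Fin m // (l : ℕ) < d j}),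
      ∑ l : Fin m, C i.1 (i.2.1 : ℕ) (l : ℕ) * v l = w i.1 (i.2.1 : ℕ) - e i.1 (i.2.1 : ℕ))] at key
  refine Eq.trans ?_ key
  congr 1
  refine congrArg Finset.card (Finset.filter_congr fun n hn => ?_)
  have hn' : n < 2 ^ m := by simpa using hn
  simp only [floor_digitalPoint hCt, hw]
  constructor
  · rintro h ⟨j, l, hl⟩
    have := h j l hl
    rw [he j l n hn'] at this
    exact eq_sub_of_add_eq this
  · intro h j k hk
    have := h ⟨j, ⟨k, hk.trans_le (hdm j)⟩, hk⟩
    rw [he j k n hn']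
    exact add_eq_of_eq_sub this

/-! ### Discrepancy of digital sequences -/

/-- `S` is contained in a dyadic interval of order `d`; it is this interval (and `len` its
length) if `d` is smaller than the resolution `m`. -/
def IsDyadicPiece (m d : ℕ) (len : ℝ) (S : Set ℝ) : Prop :=
  0 ≤ len ∧ len * 2 ^ d ≤ 1 ∧ ∃ A < 2 ^ d, (∀ y ∈ S, 0 ≤ y → y < 1 → ⌊2 ^ d * y⌋₊ = A) ∧
    (d < m → len * 2 ^ d = 1 ∧ ∀ y, 0 ≤ y → y < 1 → ⌊2 ^ d * y⌋₊ = A → y ∈ S)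

/-- Order `m` makes the exactness clause vacuous, so the empty set can serve as padding and as the
piece of a zero digit. -/
lemma isDyadicPiece_empty (m : ℕ) : IsDyadicPiece m m 0 ∅ :=
  ⟨le_rfl, by simp, 0, by positivity, by simp, by simp⟩

lemma isDyadicPiece_unit (m : ℕ) : IsDyadicPiece m 0 1 Set.univ := by
  refine ⟨by simp, by simp, 0, by simp, fun y _ h0 h1 => ?_, by simp⟩
  rw [pow_zero, one_mul, Nat.floor_eq_zero]
  exact h1

lemma floor_two_pow_succ_mul (d : ℕ) (y : ℝ) :
    ⌊2 ^ (d + 1) * y⌋₊ / 2 = ⌊2 ^ d * y⌋₊ := by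
  have := Nat.floor_div_natCast (2 ^ (d + 1) * y) 2
  rw [← this]
  congr 1
  rw [pow_succ]
  push_cast
  ring

lemma floor_two_pow_mul_div (d k : ℕ) (y : ℝ) :
    ⌊2 ^ (d + k) * y⌋₊ / 2 ^ k = ⌊2 ^ d * y⌋₊ := by
  have := Nat.floor_div_natCast (2 ^ (d + k) * y) (2 ^ k)
  rw [← this]
  congr 1
  rw [pow_add]
  push_cast
  field_simp

/-- The dyadic interval of order `i + 1` in the binary decomposition of `[0, x)`. -/
def dyadicPart (x : ℝ) (i : ℕ) : Set ℝ :=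
  {y | ⌊2 ^ (i + 1) * y⌋₊ + 1 = ⌊2 ^ (i + 1) * x⌋₊ ∧ ⌊2 ^ (i + 1) * x⌋₊ % 2 = 1}

/-- The length of `dyadicPart x i`. -/
noncomputable def dyadicLen (x : ℝ) (i : ℕ) : ℝ := (⌊2 ^ (i + 1) * x⌋₊ % 2 : ℕ) / 2 ^ (i + 1)

lemma exists_isDyadicPiece_dyadicPart {x : ℝ} (hx1 : x < 1) (i m : ℕ) :
    ∃ d, IsDyadicPiece m d (dyadicLen x i) (dyadicPart x i) := by
  rcases Nat.mod_two_eq_zero_or_one ⌊2 ^ (i + 1) * x⌋₊ with h | h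
  · have h1 : dyadicPart x i = ∅ := by simp [dyadicPart, h]
    have h2 : dyadicLen x i = 0 := by simp [dyadicLen, h]
    rw [h1, h2]
    exact ⟨m, isDyadicPiece_empty m⟩
  · have hlt : ⌊2 ^ (i + 1) * x⌋₊ < 2 ^ (i + 1) := by
      rw [Nat.floor_lt' (by positivity)]
      push_cast
      have : (0 : ℝ) < 2 ^ (i + 1) := by positivity
      nlinarith
    have hl : dyadicLen x i * 2 ^ (i + 1) = 1 := by
      simp [dyadicLen, h]
    refine ⟨i + 1, by unfold dyadicLen; positivity, hl.le, ⌊2 ^ (i + 1) * x⌋₊ - 1, by omega,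
      fun y hy _ _ => ?_, fun _ => ⟨hl, fun y _ _ hy => ⟨?_, h⟩⟩⟩
    · have := hy.1
      omega
    · omega

/-- Two prefixes are ordered by the first digit in which they differ: there `x` has digit `1` and
`y` has digit `0`. This place is unique and determines the part containing `y`. -/
lemma indicator_floor_lt_eq_sum {x : ℝ} (hx1 : x < 1) (m : ℕ) (y : ℝ) :
    (if ⌊2 ^ m * y⌋₊ < ⌊2 ^ m * x⌋₊ then 1 else 0)
      = ∑ i ∈ Finset.range m, (dyadicPart x i).indicator (1 : ℝ → ℝ) y := by
  classical
  induction m with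
  | zero =>
    have : ⌊x⌋₊ = 0 := Nat.floor_eq_zero.2 hx1
    simp [this]
  | succ m ih =>
    rw [Finset.sum_range_succ, ← ih]
    have h1 := floor_two_pow_succ_mul m x
    have h2 := floor_two_pow_succ_mul m y
    simp only [dyadicPart, Set.indicator_apply, Set.mem_ofPred_eq, Pi.one_apply]
    split_ifs <;> first | omega | norm_num

lemma sum_dyadicLen {x : ℝ} (hx1 : x < 1) (m : ℕ) :
    ∑ i ∈ Finset.range m, dyadicLen x i = ⌊2 ^ m * x⌋₊ / 2 ^ m := by
  induction m with
  | zero => simp [Nat.floor_eq_zero.2 hx1]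
  | succ m ih =>
    rw [Finset.sum_range_succ, ih, dyadicLen]
    have h1 := floor_two_pow_succ_mul m x
    have h2 : (⌊2 ^ (m + 1) * x⌋₊ : ℝ)
        = 2 * ⌊2 ^ m * x⌋₊ + (⌊2 ^ (m + 1) * x⌋₊ % 2 : ℕ) := by
      have : ⌊2 ^ (m + 1) * x⌋₊ = 2 * ⌊2 ^ m * x⌋₊ + ⌊2 ^ (m + 1) * x⌋₊ % 2 := by omega
      exact_mod_cast this
    rw [h2, pow_succ]
    field_simp

/-- A set between `[0, x)` and `[0, x]` splits into `m + 1` dyadic pieces of resolution `m`. -/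
lemma exists_dyadic_decomposition (m : ℕ) {x : ℝ} (hx0 : 0 ≤ x) (hx1 : x ≤ 1) (S : Set ℝ)
    (hlo : ∀ y, 0 ≤ y → y < 1 → y < x → y ∈ S) (hhi : ∀ y ∈ S, 0 ≤ y → y < 1 → y ≤ x) :
    ∃ (len : ℕ → ℝ) (T : ℕ → Set ℝ),
      (∀ i ∈ Finset.range (m + 1), ∃ d, IsDyadicPiece m d (len i) (T i)) ∧
      (∀ y, 0 ≤ y → y < 1 → S.indicator (1 : ℝ → ℝ) y
        = ∑ i ∈ Finset.range (m + 1), (T i).indicator (1 : ℝ → ℝ) y) ∧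
      ∑ i ∈ Finset.range (m + 1), len i = x := by
  classical
  rcases hx1.lt_or_eq with hx1 | rfl
  · refine ⟨fun i => if i < m then dyadicLen x i else x - ⌊2 ^ m * x⌋₊ / 2 ^ m,
      fun i => if i < m then dyadicPart x i else {y | y ∈ S ∧ ⌊2 ^ m * y⌋₊ = ⌊2 ^ m * x⌋₊},
      fun i _ => ?_, fun y hy0 hy1 => ?_, ?_⟩
    · by_cases hi : i < m
      · simpa only [hi, if_true] using exists_isDyadicPiece_dyadicPart hx1 i m
      · simp only [hi, if_false]
        have hp : (0 : ℝ) < 2 ^ m := by positivity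
        have h1 := Nat.floor_le (a := 2 ^ m * x) (by positivity)
        have h2 := Nat.lt_floor_add_one (2 ^ m * x)
        refine ⟨m, ?_, ?_, ⌊2 ^ m * x⌋₊, ?_, fun y hy _ _ => hy.2, fun h => (lt_irrefl _ h).elim⟩
        · rw [sub_nonneg, div_le_iff₀ hp]
          linarith
        · rw [sub_mul, div_mul_cancel₀ _ hp.ne']
          linarith
        · rw [Nat.floor_lt' (by positivity)]
          push_cast
          nlinarith
    · rw [Finset.sum_range_succ, Finset.sum_congr rfl (g := fun i =>
        (dyadicPart x i).indicator (1 : ℝ → ℝ) y) (fun i hi => by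
          simp only [Finset.mem_range] at hi
          simp only [hi, if_true]), ← indicator_floor_lt_eq_sum hx1 m y]
      simp only [lt_irrefl, if_false, Set.indicator_apply, Set.mem_ofPred_eq, Pi.one_apply]
      have hp : (0 : ℝ) < 2 ^ m := by positivity
      by_cases hy : y ∈ S
      · have : ⌊2 ^ m * y⌋₊ ≤ ⌊2 ^ m * x⌋₊ :=
          Nat.floor_le_floor (mul_le_mul_of_nonneg_left (hhi y hy hy0 hy1) hp.le)
        rcases this.lt_or_eq with h | h
        · simp [hy, h, h.ne]
        · simp [hy, h]
      · have hxy : x ≤ y := by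
          by_contra hcon
          exact hy (hlo y hy0 hy1 (not_le.1 hcon))
        have : ⌊2 ^ m * x⌋₊ ≤ ⌊2 ^ m * y⌋₊ :=
          Nat.floor_le_floor (mul_le_mul_of_nonneg_left hxy hp.le)
        simp [hy, this.not_gt]
    · rw [Finset.sum_range_succ, Finset.sum_congr rfl (g := fun i => dyadicLen x i) (fun i hi => by
          simp only [Finset.mem_range] at hi
          simp only [hi, if_true]), sum_dyadicLen hx1]
      simp
  -- For `x = 1` no cell of `[0, 1)` contains `x`; the whole unit interval is a single piece, padded
  -- with empty ones.
  · refine ⟨fun i => if i = 0 then 1 else 0, fun i => if i = 0 then Set.univ else ∅,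
      fun i _ => ?_, fun y hy0 hy1 => ?_, ?_⟩
    · by_cases hi : i = 0
      · simpa only [hi, if_true] using ⟨0, isDyadicPiece_unit m⟩
      · simpa only [hi, if_false] using ⟨m, isDyadicPiece_empty m⟩
    · rw [Finset.sum_range_succ', Finset.sum_eq_zero (fun i _ => by simp)]
      simp [hlo y hy0 hy1 hy1]
    · simp

/-- The number of points of an aligned block of length `2 ^ m` in a product of dyadic pieces. -/
lemma abs_card_pieces_sub_le {s : ℕ} (hs : 1 ≤ s) {t : ℕ} {C : Fin s → Matrix ℕ ℕ (ZMod 2)}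
    (hC : GeneratesDigitalSequence t C) (hCt : ∀ j, IsNonsingularUpperTriangular (C j))
    {m : ℕ} (htm : t ≤ m) (ℓ : ℕ) (len : Fin s → ℝ) (S : Fin s → Set ℝ)
    (hS : ∀ j, ∃ d, IsDyadicPiece m d (len j) (S j)) :
    |∑ n ∈ Finset.range (2 ^ m), ∏ j, (S j).indicator (1 : ℝ → ℝ)
        (digitalPoint C (ℓ * 2 ^ m + n) j) - 2 ^ m * ∏ j, len j| ≤ 2 ^ t := by
  classical
  choose d hlen0 hlen1 A hA hSA hfull using hS
  have hsum : ∑ n ∈ Finset.range (2 ^ m), ∏ j, (S j).indicator (1 : ℝ → ℝ)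
        (digitalPoint C (ℓ * 2 ^ m + n) j) = ((Finset.range (2 ^ m)).filter fun n =>
          ∀ j, digitalPoint C (ℓ * 2 ^ m + n) j ∈ S j).card := by
    rw [Finset.card_filter]
    push_cast
    refine Finset.sum_congr rfl fun n _ => ?_
    split_ifs with h
    · exact Finset.prod_eq_one fun j _ => by simp [h j]
    · push Not at h
      obtain ⟨j, hj⟩ := h
      exact Finset.prod_eq_zero (Finset.mem_univ j) (by simp [hj])
  rw [hsum]
  have hprod : (∏ j, len j) * 2 ^ (∑ j, d j) = ∏ j, (len j * 2 ^ d j) := by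
    rw [Finset.prod_mul_distrib, Finset.prod_pow_eq_pow_sum]
  -- If all pieces are exact and their product is large enough, it is an elementary interval with no
  -- discrepancy at all.
  by_cases hd : ∑ j, d j ≤ m - t ∧ ∀ j, d j < m
  · have hbox := card_elementary_mul hs hC hCt htm ℓ d A hd.1 hA
    have hfil : ((Finset.range (2 ^ m)).filter fun n =>
          ∀ j, digitalPoint C (ℓ * 2 ^ m + n) j ∈ S j)
        = ((Finset.range (2 ^ m)).filter fun n =>
          ∀ j, ⌊2 ^ d j * digitalPoint C (ℓ * 2 ^ m + n) j⌋₊ = A j) := by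
      refine Finset.filter_congr fun n _ => forall_congr' fun j => ?_
      have hp := digitalPoint_mem_Ico hCt (ℓ * 2 ^ m + n) j
      exact ⟨fun h => hSA j _ h hp.1 hp.2, fun h => (hfull j (hd.2 j)).2 _ hp.1 hp.2 h⟩
    rw [hfil]
    have h1 : (∏ j, len j) * 2 ^ (∑ j, d j) = 1 := by
      rw [hprod]
      exact Finset.prod_eq_one fun j _ => (hfull j (hd.2 j)).1
    have h2 : ((((Finset.range (2 ^ m)).filter fun n =>
          ∀ j, ⌊2 ^ d j * digitalPoint C (ℓ * 2 ^ m + n) j⌋₊ = A j).card : ℕ) : ℝ)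
          * 2 ^ (∑ j, d j) = 2 ^ m := by
      exact_mod_cast hbox
    have hp : (0 : ℝ) < 2 ^ (∑ j, d j) := by positivity
    have h3 : ((((Finset.range (2 ^ m)).filter fun n =>
          ∀ j, ⌊2 ^ d j * digitalPoint C (ℓ * 2 ^ m + n) j⌋₊ = A j).card : ℕ) : ℝ)
        = 2 ^ m * ∏ j, len j := by
      apply mul_right_cancel₀ hp.ne'
      rw [h2, mul_assoc, h1, mul_one]
    rw [h3, sub_self, abs_zero]
    positivity
  · have hge : m - t ≤ ∑ j, d j := by
      by_contra hcon
      push Not at hcon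
      refine hd ⟨hcon.le, fun j => ?_⟩
      have := Finset.single_le_sum (f := d) (fun i _ => Nat.zero_le _) (Finset.mem_univ j)
      omega
    -- Coarsening the orders to sum `m - t` gives an elementary interval with exactly `2 ^ t` points
    -- that contains all points counted. The expected number is at most `2 ^ t` too, so two numbers
    -- in `[0, 2 ^ t]` are compared.
    obtain ⟨d', hdd, hd'⟩ := exists_le_sum_eq d _ hge
    have hbox := card_elementary_mul hs hC hCt htm ℓ d' (fun j => A j / 2 ^ (d j - d' j)) hd'.le
      (fun j => by
        rw [Nat.div_lt_iff_lt_mul (by positivity), ← pow_add]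
        have : d' j + (d j - d' j) = d j := by have := hdd j; omega
        rw [this]
        exact hA j)
    have hmt : 2 ^ m = 2 ^ t * 2 ^ (m - t) := by rw [← pow_add]; congr 1; omega
    rw [hd', hmt] at hbox
    have hbox' := Nat.eq_of_mul_eq_mul_right (by positivity) hbox
    have hle : (((Finset.range (2 ^ m)).filter fun n =>
          ∀ j, digitalPoint C (ℓ * 2 ^ m + n) j ∈ S j).card : ℝ) ≤ 2 ^ t := by
      have : ((Finset.range (2 ^ m)).filter fun n =>
          ∀ j, digitalPoint C (ℓ * 2 ^ m + n) j ∈ S j).card ≤ 2 ^ t := by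
        rw [← hbox', ← hmt]
        refine Finset.card_le_card (Finset.monotone_filter_right _ fun n _ h j => ?_)
        have hp := digitalPoint_mem_Ico hCt (ℓ * 2 ^ m + n) j
        have h1 := hSA j _ (h j) hp.1 hp.2
        have h2 := floor_two_pow_mul_div (d' j) (d j - d' j) (digitalPoint C (ℓ * 2 ^ m + n) j)
        have : d' j + (d j - d' j) = d j := by have := hdd j; omega
        rw [this, h1] at h2
        exact h2.symm
      exact_mod_cast this
    have hle2 : 2 ^ m * ∏ j, len j ≤ (2 : ℝ) ^ t := by
      have h1 : (∏ j, len j) * 2 ^ (∑ j, d j) ≤ 1 := by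
        rw [hprod]
        exact Finset.prod_le_one (fun j _ => mul_nonneg (hlen0 j) (by positivity))
          fun j _ => hlen1 j
      have h2 : (∏ j, len j) * 2 ^ (m - t) ≤ 1 := by
        refine le_trans ?_ h1
        refine mul_le_mul_of_nonneg_left ?_ (Finset.prod_nonneg fun j _ => hlen0 j)
        exact pow_le_pow_right₀ (by norm_num) hge
      have h3 : (2 : ℝ) ^ m = 2 ^ t * 2 ^ (m - t) := by exact_mod_cast hmt
      rw [h3, mul_assoc, mul_comm (2 ^ (m - t) : ℝ)]
      exact mul_le_of_le_one_right (by positivity) h2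
    have h0 : (0 : ℝ) ≤ 2 ^ m * ∏ j, len j :=
      mul_nonneg (by positivity) (Finset.prod_nonneg fun j _ => hlen0 j)
    rw [abs_le]
    constructor
    · have := Nat.cast_nonneg (α := ℝ) ((Finset.range (2 ^ m)).filter fun n =>
          ∀ j, digitalPoint C (ℓ * 2 ^ m + n) j ∈ S j).card
      linarith
    · linarith

/-- Local discrepancy of an aligned block of length `2 ^ m`. -/
lemma abs_block_discrepancy_le {s : ℕ} (hs : 1 ≤ s) {t : ℕ} {C : Fin s → Matrix ℕ ℕ (ZMod 2)}
    (hC : GeneratesDigitalSequence t C) (hCt : ∀ j, IsNonsingularUpperTriangular (C j))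
    (m ℓ : ℕ) (u : Finset (Fin s)) (x : Fin s → ℝ) (hx0 : ∀ j, 0 ≤ x j) (hx1 : ∀ j, x j ≤ 1)
    (S : Fin s → Set ℝ) (hlo : ∀ j, ∀ y, 0 ≤ y → y < 1 → y < x j → y ∈ S j)
    (hhi : ∀ j, ∀ y ∈ S j, 0 ≤ y → y < 1 → y ≤ x j) :
    |∑ n ∈ Finset.range (2 ^ m), ∏ j ∈ u, (S j).indicator (1 : ℝ → ℝ)
        (digitalPoint C (ℓ * 2 ^ m + n) j) - 2 ^ m * ∏ j ∈ u, x j|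
      ≤ 2 ^ t * (m + 1) ^ u.card := by
  classical
  by_cases htm : t ≤ m
  · choose len T hT hST hlen using fun j =>
      exists_dyadic_decomposition m (hx0 j) (hx1 j) (S j) (hlo j) (hhi j)
    -- Directions outside `u` receive one trivial piece, so that products over `u` become products
    -- over all directions.
    let I : Fin s → Finset ℕ := fun j => if j ∈ u then Finset.range (m + 1) else {0}
    let len' : Fin s → ℕ → ℝ := fun j i => if j ∈ u then len j i else 1
    let T' : Fin s → ℕ → Set ℝ := fun j i => if j ∈ u then T j i else Set.univ
    have hx : ∏ j ∈ u, x j = ∑ i ∈ Fintype.piFinset I, ∏ j, len' j (i j) := by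
      rw [← Finset.prod_univ_sum, ← Finset.prod_subset (Finset.subset_univ u)]
      · refine Finset.prod_congr rfl fun j hj => ?_
        simp [I, len', hj, hlen]
      · intro j _ hj
        simp [I, len', hj]
    have hS : ∀ n, ∏ j ∈ u, (S j).indicator (1 : ℝ → ℝ) (digitalPoint C (ℓ * 2 ^ m + n) j)
        = ∑ i ∈ Fintype.piFinset I, ∏ j, (T' j (i j)).indicator (1 : ℝ → ℝ)
          (digitalPoint C (ℓ * 2 ^ m + n) j) := by
      intro n
      rw [← Finset.prod_univ_sum (f := fun j i => (T' j i).indicator (1 : ℝ → ℝ)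
          (digitalPoint C (ℓ * 2 ^ m + n) j)), ← Finset.prod_subset (Finset.subset_univ u)]
      · refine Finset.prod_congr rfl fun j hj => ?_
        have hp := digitalPoint_mem_Ico hCt (ℓ * 2 ^ m + n) j
        simp only [I, T', hj, if_true]
        exact hST j _ hp.1 hp.2
      · intro j _ hj
        simp [I, T', hj]
    simp_rw [hS]
    rw [hx, Finset.sum_comm, Finset.mul_sum, ← Finset.sum_sub_distrib]
    refine (Finset.abs_sum_le_sum_abs _ _).trans ?_
    have hterm : ∀ i ∈ Fintype.piFinset I,
        |∑ n ∈ Finset.range (2 ^ m), ∏ j, (T' j (i j)).indicator (1 : ℝ → ℝ)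
          (digitalPoint C (ℓ * 2 ^ m + n) j) - 2 ^ m * ∏ j, len' j (i j)| ≤ 2 ^ t := by
      intro i hi
      refine abs_card_pieces_sub_le hs hC hCt htm ℓ (fun j => len' j (i j))
        (fun j => T' j (i j)) fun j => ?_
      have hij := Fintype.mem_piFinset.1 hi j
      by_cases hj : j ∈ u
      · simp only [I, T', len', hj, if_true] at hij ⊢
        exact hT j _ hij
      · simp only [T', len', hj, if_false]
        exact ⟨0, isDyadicPiece_unit m⟩
    refine (Finset.sum_le_sum hterm).trans ?_
    have hcard : (Fintype.piFinset I).card = (m + 1) ^ u.card := by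
      rw [Fintype.card_piFinset, ← Finset.prod_subset (Finset.subset_univ u)]
      · rw [Finset.prod_congr rfl (g := fun _ => m + 1) (fun j hj => by simp [I, hj]),
          Finset.prod_const]
      · intro j _ hj
        simp [I, hj]
    rw [Finset.sum_const, hcard, nsmul_eq_mul, mul_comm]
    push_cast
    exact le_rfl
  -- For `m < t` the trivial bound works: both quantities lie in `[0, 2 ^ m]`.
  · have hpm : (2 : ℝ) ^ m ≤ 2 ^ t := pow_le_pow_right₀ (by norm_num) (by omega)
    have h1 : (2 : ℝ) ^ t ≤ 2 ^ t * (m + 1) ^ u.card :=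
      le_mul_of_one_le_right (by positivity)
        (one_le_pow₀ (by linarith [(Nat.cast_nonneg m : (0 : ℝ) ≤ m)]))
    have h2 : 0 ≤ ∑ n ∈ Finset.range (2 ^ m), ∏ j ∈ u, (S j).indicator (1 : ℝ → ℝ)
        (digitalPoint C (ℓ * 2 ^ m + n) j) :=
      Finset.sum_nonneg fun n _ => Finset.prod_nonneg fun j _ =>
        Set.indicator_nonneg (fun _ _ => zero_le_one) _
    have h3 : ∑ n ∈ Finset.range (2 ^ m), ∏ j ∈ u, (S j).indicator (1 : ℝ → ℝ)
        (digitalPoint C (ℓ * 2 ^ m + n) j) ≤ 2 ^ m := by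
      have hone : ∀ n ∈ Finset.range (2 ^ m), ∏ j ∈ u, (S j).indicator (1 : ℝ → ℝ)
          (digitalPoint C (ℓ * 2 ^ m + n) j) ≤ 1 := fun n _ =>
        Finset.prod_le_one (fun j _ => Set.indicator_nonneg (fun _ _ => zero_le_one) _)
          fun j _ => by
            rw [Set.indicator_apply]
            split_ifs <;> simp
      exact (Finset.sum_le_sum hone).trans (by simp)
    have h4 : 0 ≤ ∏ j ∈ u, x j := Finset.prod_nonneg fun j _ => hx0 j
    have h5 : ∏ j ∈ u, x j ≤ 1 := Finset.prod_le_one (fun j _ => hx0 j) fun j _ => hx1 j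
    have h6 : (0 : ℝ) < 2 ^ m := by positivity
    rw [abs_le]
    constructor <;> nlinarith

/-- Local discrepancy of an initial part of an aligned block of length `2 ^ M`. -/
lemma abs_segment_discrepancy_le {s : ℕ} (hs : 1 ≤ s) {t : ℕ} {C : Fin s → Matrix ℕ ℕ (ZMod 2)}
    (hC : GeneratesDigitalSequence t C) (hCt : ∀ j, IsNonsingularUpperTriangular (C j))
    (u : Finset (Fin s)) (x : Fin s → ℝ) (hx0 : ∀ j, 0 ≤ x j) (hx1 : ∀ j, x j ≤ 1)
    (S : Fin s → Set ℝ) (hlo : ∀ j, ∀ y, 0 ≤ y → y < 1 → y < x j → y ∈ S j)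
    (hhi : ∀ j, ∀ y ∈ S j, 0 ≤ y → y < 1 → y ≤ x j) (M ℓ R : ℕ) (hR : R < 2 ^ M) :
    |∑ n ∈ Finset.range R, ∏ j ∈ u, (S j).indicator (1 : ℝ → ℝ)
        (digitalPoint C (ℓ * 2 ^ M + n) j) - R * ∏ j ∈ u, x j|
      ≤ M * (2 ^ t * M ^ u.card) := by
  induction M generalizing ℓ R with
  | zero =>
    have : R = 0 := by simpa using hR
    simp [this]
  | succ M ih =>
    have hmono : (M : ℝ) * (2 ^ t * M ^ u.card) ≤ M * (2 ^ t * (M + 1) ^ u.card) := by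
      gcongr
      linarith
    -- Either the segment stays in the first half of the block, or it consists of that half and a
    -- segment of the second half. At most one block of each length occurs, hence the factor `M`.
    rcases lt_or_ge R (2 ^ M) with h | h
    · have := ih (2 * ℓ) R h
      rw [show 2 * ℓ * 2 ^ M = ℓ * 2 ^ (M + 1) by ring] at this
      refine this.trans (hmono.trans ?_)
      push_cast
      gcongr
      linarith
    · obtain ⟨R', rfl⟩ := Nat.exists_eq_add_of_le h
      have h1 := abs_block_discrepancy_le hs hC hCt M (2 * ℓ) u x hx0 hx1 S hlo hhi
      have h2 := ih (2 * ℓ + 1) R' (by rw [pow_succ] at hR; omega)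
      rw [show 2 * ℓ * 2 ^ M = ℓ * 2 ^ (M + 1) by ring] at h1
      rw [show (2 * ℓ + 1) * 2 ^ M = ℓ * 2 ^ (M + 1) + 2 ^ M by ring] at h2
      rw [Finset.sum_range_add]
      simp only [add_assoc] at h2
      push_cast
      have h3 := (abs_add_le _ _).trans (add_le_add h1 h2)
      refine le_trans (le_of_eq ?_) (h3.trans ?_)
      · congr 1
        ring
      · linarith

/-- The local discrepancy of the first `R` points, where `R < 2 ^ M`. -/
lemma abs_discrepancy_le {s : ℕ} (hs : 1 ≤ s) {t : ℕ} {C : Fin s → Matrix ℕ ℕ (ZMod 2)}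
    (hC : GeneratesDigitalSequence t C) (hCt : ∀ j, IsNonsingularUpperTriangular (C j))
    (u : Finset (Fin s)) (x : Fin s → ℝ) (hx0 : ∀ j, 0 ≤ x j) (hx1 : ∀ j, x j ≤ 1)
    (S : Fin s → Set ℝ) (hlo : ∀ j, ∀ y, 0 ≤ y → y < 1 → y < x j → y ∈ S j)
    (hhi : ∀ j, ∀ y ∈ S j, 0 ≤ y → y < 1 → y ≤ x j) (M R : ℕ) (hR : R < 2 ^ M) :
    |∑ n ∈ Finset.range R, ∏ j ∈ u, (S j).indicator (1 : ℝ → ℝ) (digitalPoint C n j)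
        - R * ∏ j ∈ u, x j| ≤ 2 ^ t * M ^ (u.card + 1) := by
  have := abs_segment_discrepancy_le hs hC hCt u x hx0 hx1 S hlo hhi M 0 R hR
  simp only [zero_mul, zero_add] at this
  refine this.trans (le_of_eq ?_)
  ring

/-! ### Mixed differences -/

lemma mixedPartial_empty {s : ℕ} (a b : Fin s → ℝ) (f : (Fin s → ℝ) → ℝ) :
    mixedPartial a b ∅ f = f := by
  simp [mixedPartial]

lemma sort_insert_of_forall_lt {s : ℕ} {c : Fin s} {u : Finset (Fin s)} (hc : ∀ i ∈ u, i < c) :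
    (insert c u).sort (· ≤ ·) = u.sort (· ≤ ·) ++ [c] := by
  have hcu : c ∉ u := fun h => lt_irrefl _ (hc c h)
  refine List.Perm.eq_of_pairwise' (r := (· ≤ ·)) (Finset.pairwise_sort _ _) ?_ ?_
  · rw [List.pairwise_append]
    refine ⟨Finset.pairwise_sort _ _, List.pairwise_singleton _ _, fun x hx y hy => ?_⟩
    rw [List.mem_singleton] at hy
    subst hy
    exact (hc x ((Finset.mem_sort _).1 hx)).le
  · rw [List.perm_ext_iff_of_nodup (Finset.sort_nodup _ _)]
    · intro x
      simp [or_comm]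
    · rw [List.nodup_append]
      refine ⟨Finset.sort_nodup _ _, List.nodup_singleton _, ?_⟩
      simp only [Finset.mem_sort, List.mem_singleton]
      rintro x hx y rfl rfl
      exact hcu hx

/-- `foldr` applies the last entry first, so the largest direction is differentiated first. This
matches induction on the maximum of `u`. -/
lemma mixedPartial_insert {s : ℕ} (a b : Fin s → ℝ) (f : (Fin s → ℝ) → ℝ) {c : Fin s}
    {u : Finset (Fin s)} (hc : ∀ i ∈ u, i < c) :
    mixedPartial a b (insert c u) f = mixedPartial a b u (partialDeriv a b c f) := by
  simp [mixedPartial, sort_insert_of_forall_lt hc]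

/-- The alternating sum of the values of `f` at the vertices of the face of the box with opposite
vertices `lo` and `hi` that is spanned by the directions in `u` and contains `hi`. -/
noncomputable def mixedDiff {s : ℕ} (lo hi : Fin s → ℝ) (u : Finset (Fin s))
    (f : (Fin s → ℝ) → ℝ) : ℝ :=
  ∑ v ∈ u.powerset, (-1) ^ v.card * f (v.piecewise lo hi)

lemma update_mem_Icc {s : ℕ} {a b x : Fin s → ℝ} (hx : x ∈ Set.Icc a b) {c : Fin s} {τ : ℝ}
    (hτ : τ ∈ Set.Icc (a c) (b c)) : Function.update x c τ ∈ Set.Icc a b := by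
  constructor <;> intro i
  · by_cases hi : i = c
    · subst hi; simpa using hτ.1
    · simpa [hi] using hx.1 i
  · by_cases hi : i = c
    · subst hi; simpa using hτ.2
    · simpa [hi] using hx.2 i

lemma piecewise_mem_Icc {s : ℕ} {a b x y : Fin s → ℝ} (hx : x ∈ Set.Icc a b)
    (hy : y ∈ Set.Icc a b) (v : Finset (Fin s)) : v.piecewise x y ∈ Set.Icc a b := by
  constructor <;> intro i <;> by_cases hi : i ∈ v
  · simpa [hi] using hx.1 i
  · simpa [hi] using hy.1 i
  · simpa [hi] using hx.2 i
  · simpa [hi] using hy.2 i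

/-- The vertices pair up along direction `c`; a mixed difference thus becomes an increment in one
variable, open to the mean value inequality. -/
lemma mixedDiff_insert {s : ℕ} (lo hi : Fin s → ℝ) {c : Fin s} {u : Finset (Fin s)} (hc : c ∉ u)
    (f : (Fin s → ℝ) → ℝ) :
    mixedDiff lo hi (insert c u) f
      = mixedDiff lo hi u f - mixedDiff lo (Function.update hi c (lo c)) u f := by
  unfold mixedDiff
  rw [Finset.sum_powerset_insert hc, sub_eq_add_neg, ← Finset.sum_neg_distrib]
  congr 1
  refine Finset.sum_congr rfl fun v hv => ?_
  have hcv : c ∉ v := fun h => hc (Finset.mem_powerset.1 hv h)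
  rw [Finset.card_insert_of_notMem hcv, pow_succ]
  have : (insert c v).piecewise lo hi = v.piecewise lo (Function.update hi c (lo c)) := by
    funext i
    by_cases hi' : i = c
    · subst hi'; simp [hcv]
    · by_cases hv' : i ∈ v <;> simp [hi', hv']
  rw [this]
  ring

/-- Mean value inequality for mixed differences. -/
lemma abs_mixedDiff_le {s : ℕ} {a b : Fin s → ℝ} (u : Finset (Fin s)) (f : (Fin s → ℝ) → ℝ)
    (hf : ∀ w ⊆ u, ∀ j ∈ u, (∀ i ∈ w, j < i) → ∀ x ∈ Set.Icc a b,
      DifferentiableWithinAt ℝ (fun τ => mixedPartial a b w f (Function.update x j τ))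
        (Set.Icc (a j) (b j)) (x j))
    (lo hi : Fin s → ℝ) (hlo : lo ∈ Set.Icc a b) (hhi : hi ∈ Set.Icc a b) (M : ℝ)
    (hM : ∀ x ∈ Set.Icc a b, |mixedPartial a b u f x| ≤ M) :
    |mixedDiff lo hi u f| ≤ M * ∏ j ∈ u, |hi j - lo j| := by
  induction u using Finset.induction_on_max generalizing f lo hi with
  | empty => simpa [mixedDiff, mixedPartial_empty] using hM hi hhi
  | insert c u hc ih =>
    have hcu : c ∉ u := fun h => lt_irrefl _ (hc c h)
    have hlo_c : lo c ∈ Set.Icc (a c) (b c) := ⟨hlo.1 c, hlo.2 c⟩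
    have hhi_c : hi c ∈ Set.Icc (a c) (b c) := ⟨hhi.1 c, hhi.2 c⟩
    -- A vertex set `v ⊆ u` omits `c`, so `τ` enters each summand through coordinate `c` alone.
    have hderiv : ∀ τ ∈ Set.Icc (a c) (b c),
        HasDerivWithinAt (fun τ => mixedDiff lo (Function.update hi c τ) u f)
          (mixedDiff lo (Function.update hi c τ) u (partialDeriv a b c f))
          (Set.Icc (a c) (b c)) τ := by
      intro τ hτ
      unfold mixedDiff
      refine HasDerivWithinAt.fun_sum fun v hv => HasDerivWithinAt.const_mul _ ?_
      have hcv : c ∉ v := fun h => hcu (Finset.mem_powerset.1 hv h)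
      have hupd : ∀ τ, v.piecewise lo (Function.update hi c τ)
          = Function.update (v.piecewise lo hi) c τ := fun τ =>
        (Finset.update_piecewise_of_notMem _ _ _ hcv _).symm
      simp only [hupd]
      have hx := update_mem_Icc (piecewise_mem_Icc hlo hhi v) hτ
      have h := (hf ∅ (Finset.empty_subset _) c (Finset.mem_insert_self _ _) (by simp) _
        hx).hasDerivWithinAt
      simpa [mixedPartial_empty, partialDeriv] using h
    have hbound : ∀ τ ∈ Set.Icc (a c) (b c),
        ‖mixedDiff lo (Function.update hi c τ) u (partialDeriv a b c f)‖
          ≤ M * ∏ j ∈ u, |hi j - lo j| := by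
      intro τ hτ
      have h := ih (partialDeriv a b c f) (fun w hw j hj hjw x hx => ?_) lo
        (Function.update hi c τ) hlo (update_mem_Icc hhi hτ) ?_
      · rw [Real.norm_eq_abs]
        refine h.trans (le_of_eq ?_)
        congr 1
        refine Finset.prod_congr rfl fun j hj => ?_
        rw [Function.update_of_ne (ne_of_mem_of_not_mem hj hcu)]
      · rw [← mixedPartial_insert a b f (fun i hi => hc i (hw hi))]
        refine hf (insert c w) (Finset.insert_subset_insert _ hw) j (Finset.mem_insert_of_mem hj)
          (fun i hi => ?_) x hx
        rcases Finset.mem_insert.1 hi with rfl | hi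
        · exact hc j hj
        · exact hjw i hi
      · intro x hx
        rw [← mixedPartial_insert a b f hc]
        exact hM x hx
    have h := (convex_Icc (a c) (b c)).norm_image_sub_le_of_norm_hasDerivWithin_le hderiv hbound
      hlo_c hhi_c
    rw [mixedDiff_insert lo hi hcu, Finset.prod_insert hcu]
    simp only [Function.update_eq_self, Real.norm_eq_abs] at h
    refine h.trans (le_of_eq ?_)
    ring

lemma HasMixedPartials.abs_mixedDiff_le {s : ℕ} {a b : Fin s → ℝ} {f : (Fin s → ℝ) → ℝ}
    (hf : HasMixedPartials a b f) (u : Finset (Fin s))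
    {lo hi : Fin s → ℝ} (hlo : lo ∈ Set.Icc a b) (hhi : hi ∈ Set.Icc a b) {M : ℝ}
    (hM : ∀ x ∈ Set.Icc a b, |mixedPartial a b u f x| ≤ M) :
    |mixedDiff lo hi u f| ≤ M * ∏ j ∈ u, |hi j - lo j| :=
  HatQMC.abs_mixedDiff_le u f (fun w _ j _ hj => hf w j hj) lo hi hlo hhi M hM

/-- The coordinates are changed from `y` to `x` one at a time; each change is a mixed difference in
a single direction. -/
lemma HasMixedPartials.abs_sub_le {s : ℕ} {a b : Fin s → ℝ} {f : (Fin s → ℝ) → ℝ}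
    (hf : HasMixedPartials a b f) {M : Fin s → ℝ}
    (hM : ∀ j, ∀ x ∈ Set.Icc a b, |mixedPartial a b {j} f x| ≤ M j)
    {x y : Fin s → ℝ} (hx : x ∈ Set.Icc a b) (hy : y ∈ Set.Icc a b) :
    |f x - f y| ≤ ∑ j, M j * |x j - y j| := by
  have key : ∀ v : Finset (Fin s), |f (v.piecewise x y) - f y| ≤ ∑ j ∈ v, M j * |x j - y j| := by
    intro v
    induction v using Finset.induction_on with
    | empty => simp
    | insert c v hc ih =>
      have hz := piecewise_mem_Icc hx hy v
      have hz' := piecewise_mem_Icc hx hy (insert c v)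
      have h := hf.abs_mixedDiff_le {c} hz hz' (hM c)
      have hdiff : mixedDiff (v.piecewise x y) ((insert c v).piecewise x y) {c} f
          = f ((insert c v).piecewise x y) - f (v.piecewise x y) := by
        have hpw : Function.update ((insert c v).piecewise x y) c (v.piecewise x y c)
            = v.piecewise x y := by
          funext i
          by_cases hi : i = c
          · subst hi; simp
          · by_cases hi' : i ∈ v <;> simp [hi, hi']
        rw [← insert_empty_eq, mixedDiff_insert _ _ (Finset.notMem_empty c), hpw]
        simp [mixedDiff]
      rw [hdiff] at h
      simp only [Finset.prod_singleton, Finset.piecewise_eq_of_mem _ _ _ (Finset.mem_insert_self c v),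
        Finset.piecewise_eq_of_notMem _ _ _ hc] at h
      rw [Finset.sum_insert hc]
      calc |f ((insert c v).piecewise x y) - f y|
          ≤ |f ((insert c v).piecewise x y) - f (v.piecewise x y)|
            + |f (v.piecewise x y) - f y| := _root_.abs_sub_le _ _ _
        _ ≤ _ := add_le_add h ih
  simpa using key Finset.univ

lemma HasMixedPartials.continuousOn {s : ℕ} {a b : Fin s → ℝ} {f : (Fin s → ℝ) → ℝ}
    (hf : HasMixedPartials a b f) {M : Fin s → ℝ}
    (hM : ∀ j, ∀ x ∈ Set.Icc a b, |mixedPartial a b {j} f x| ≤ M j) :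
    ContinuousOn f (Set.Icc a b) := by
  intro y hy
  have hlim : Filter.Tendsto (fun x => ∑ j, M j * |x j - y j|) (nhdsWithin y (Set.Icc a b))
      (nhds 0) := by
    have : Continuous fun x : Fin s → ℝ => ∑ j, M j * |x j - y j| := by fun_prop
    have h := (this.tendsto y).mono_left (nhdsWithin_le_nhds (s := Set.Icc a b))
    simpa using h
  rw [ContinuousWithinAt, tendsto_iff_norm_sub_tendsto_zero]
  refine squeeze_zero' (Filter.Eventually.of_forall fun x => norm_nonneg _) ?_ hlim
  filter_upwards [self_mem_nhdsWithin] with x hx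
  exact hf.abs_sub_le hM hx hy

/-! ### A Koksma-Hlawka inequality for functions with bounded mixed partial derivatives -/

lemma sum_telescope_ite (n z x : ℕ) :
    ∑ i ∈ Finset.range n, ((if z = i + 1 then (1 : ℝ) else 0) - (if z = i then 1 else 0))
        * (if x ≤ i then 1 else 0)
      = (if z ≤ n ∧ x < z then 1 else 0) - (if z < n ∧ x ≤ z then 1 else 0) := by
  induction n with
  | zero =>
    rw [Finset.range_zero, Finset.sum_empty]
    split_ifs <;> first | omega | norm_num
  | succ n ih =>
    rw [Finset.sum_range_succ, ih]
    split_ifs <;> first | omega | norm_num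

/-- The coefficient of the value at the node `z` in the `i`-th difference functional on the nodes
`0, …, n`: it is the evaluation at `n` for `i = n` and a forward difference for `i < n`. -/
def diffCoeff (n i z : ℕ) : ℝ :=
  (if i < n then -(if z = i then 1 else 0) else 0) + (if z = min (i + 1) n then 1 else 0)

/-- The functions dual to the difference functionals. -/
def stepFun (n i : ℕ) (P : Prop) [Decidable P] : ℝ :=
  if i = n then 1 else if P then -1 else 0

/-- This is summation by parts: `f x = f n - ∑ (f (i + 1) - f i)`, summed over `x ≤ i < n`, read off
as the coefficient of `f z`. -/
lemma sum_diffCoeff_mul_stepFun {n z x : ℕ} (hz : z ≤ n) (hx : x ≤ n) :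
    ∑ i ∈ Finset.range (n + 1), diffCoeff n i z * stepFun n i (x ≤ i)
      = if z = x then 1 else 0 := by
  have h : ∀ i ∈ Finset.range n, diffCoeff n i z * stepFun n i (x ≤ i)
      = -(((if z = i + 1 then (1 : ℝ) else 0) - (if z = i then 1 else 0))
        * (if x ≤ i then 1 else 0)) := by
    intro i hi
    have hi' := Finset.mem_range.1 hi
    have : min (i + 1) n = i + 1 := by omega
    simp only [diffCoeff, stepFun, hi', hi'.ne, this, if_true, if_false]
    split_ifs <;> norm_num
  rw [Finset.sum_range_succ, Finset.sum_congr rfl h, Finset.sum_neg_distrib, sum_telescope_ite]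
  have : min (n + 1) n = n := by omega
  simp only [diffCoeff, stepFun, lt_irrefl, this, if_true, if_false]
  split_ifs <;> first | omega | norm_num

/-- The points of the equidistant grid with `n ^ s` cells on `[a, b]`. -/
noncomputable def gridPt {s : ℕ} (a b : Fin s → ℝ) (n : ℕ) (z : Fin s → ℕ) : Fin s → ℝ :=
  fun j => a j + (b j - a j) * (z j / n)

lemma gridPt_mem_Icc {s : ℕ} {a b : Fin s → ℝ} (hab : ∀ j, a j < b j) {n : ℕ} (hn : 0 < n)
    {z : Fin s → ℕ} (hz : ∀ j, z j ≤ n) : gridPt a b n z ∈ Set.Icc a b := by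
  have hn' : (0 : ℝ) < n := by exact_mod_cast hn
  have h1 : ∀ j, (0 : ℝ) ≤ z j / n := fun j => by positivity
  have h2 : ∀ j, (z j : ℝ) / n ≤ 1 := fun j => by
    rw [div_le_one hn']
    exact_mod_cast hz j
  constructor <;> intro j <;> simp only [gridPt] <;> have := hab j <;> nlinarith [h1 j, h2 j]

/-- The index of the upper vertex of the cell of the equidistant grid that contains `x`. -/
noncomputable def gridCeil {s : ℕ} (a b : Fin s → ℝ) (n : ℕ) (x : Fin s → ℝ) : Fin s → ℕ :=
  fun j => ⌈n * (x j - a j) / (b j - a j)⌉₊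

lemma gridCeil_le_iff {s : ℕ} {a b : Fin s → ℝ} (hab : ∀ j, a j < b j) {n : ℕ} (hn : 0 < n)
    (x : Fin s → ℝ) (i : Fin s → ℕ) (j : Fin s) :
    gridCeil a b n x j ≤ i j ↔ x j ≤ gridPt a b n i j := by
  have hn' : (0 : ℝ) < n := by exact_mod_cast hn
  have hb : 0 < b j - a j := sub_pos.2 (hab j)
  rw [gridCeil, Nat.ceil_le, div_le_iff₀ hb, gridPt, ← sub_le_iff_le_add', ← mul_div_assoc,
    le_div_iff₀ hn', mul_comm (x j - a j), mul_comm (b j - a j)]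

lemma gridCeil_le {s : ℕ} {a b : Fin s → ℝ} (hab : ∀ j, a j < b j) {n : ℕ} (hn : 0 < n)
    {x : Fin s → ℝ} (hx : x ∈ Set.Icc a b) (j : Fin s) : gridCeil a b n x j ≤ n := by
  have hn' : (n : ℝ) ≠ 0 := by positivity
  refine (gridCeil_le_iff hab hn x (fun _ => n) j).2 ?_
  simpa [gridPt, hn'] using hx.2 j

lemma abs_gridPt_gridCeil_sub_le {s : ℕ} {a b : Fin s → ℝ} (hab : ∀ j, a j < b j) {n : ℕ}
    (hn : 0 < n) {x : Fin s → ℝ} (hx : x ∈ Set.Icc a b) (j : Fin s) :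
    |x j - gridPt a b n (gridCeil a b n x) j| ≤ (b j - a j) / n := by
  have hn' : (0 : ℝ) < n := by exact_mod_cast hn
  have hb : 0 < b j - a j := sub_pos.2 (hab j)
  have h1 := (gridCeil_le_iff hab hn x (gridCeil a b n x) j).1 le_rfl
  have h2 : (gridCeil a b n x j : ℝ) < n * (x j - a j) / (b j - a j) + 1 :=
    Nat.ceil_lt_add_one (by
      have := hx.1 j
      have : 0 ≤ x j - a j := by linarith
      positivity)
  rw [abs_sub_comm, abs_of_nonneg (sub_nonneg.2 h1)]
  have h3 : (b j - a j) * (gridCeil a b n x j / n)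
      ≤ (b j - a j) * ((n * (x j - a j) / (b j - a j) + 1) / n) := by gcongr
  have h4 : (b j - a j) * ((n * (x j - a j) / (b j - a j) + 1) / n)
      = (x j - a j) + (b j - a j) / n := by field_simp
  simp only [gridPt]
  linarith

/-- The tensor product of difference functionals is a mixed difference. -/
lemma sum_prod_diffCoeff {s : ℕ} (a b : Fin s → ℝ) (n : ℕ) (f : (Fin s → ℝ) → ℝ)
    (i : Fin s → ℕ) (hi : ∀ j, i j ≤ n) :
    ∑ z ∈ Fintype.piFinset fun _ => Finset.range (n + 1),
        f (gridPt a b n z) * ∏ j, diffCoeff n (i j) (z j)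
      = mixedDiff (gridPt a b n i) (gridPt a b n fun j => min (i j + 1) n)
        (Finset.univ.filter fun j => i j < n) f := by
  classical
  set u := Finset.univ.filter fun j => i j < n with hu
  have hexp : ∀ z : Fin s → ℕ, ∏ j, diffCoeff n (i j) (z j)
      = ∑ v ∈ u.powerset, (-1) ^ v.card *
        (if z = v.piecewise i (fun j => min (i j + 1) n) then 1 else 0) := by
    intro z
    simp only [diffCoeff]
    -- Expanding chooses the lower or the upper node in each direction. Choosing the lower one where
    -- `i j = n` contributes zero, which leaves the subsets of `u`.
    rw [Finset.prod_add]
    symm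
    refine Finset.sum_subset_zero_on_sdiff (Finset.powerset_mono.2 (Finset.subset_univ u))
      (fun v hv => ?_) (fun v hv => ?_)
    · have hvu : ¬ v ⊆ u := fun h => (Finset.mem_sdiff.1 hv).2 (Finset.mem_powerset.2 h)
      obtain ⟨j, hj, hju⟩ := Finset.not_subset.1 hvu
      have hj' : ¬ i j < n := by simpa [hu] using hju
      rw [Finset.prod_eq_zero hj (by simp [hj']), zero_mul]
    · have hvu := Finset.mem_powerset.1 hv
      have h1 : ∏ j ∈ v, (if i j < n then -(if z j = i j then (1 : ℝ) else 0) else 0)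
          = (-1) ^ v.card * ∏ j ∈ v, (if z j = i j then (1 : ℝ) else 0) := by
        rw [← Finset.prod_const, ← Finset.prod_mul_distrib]
        refine Finset.prod_congr rfl fun j hj => ?_
        have : i j < n := by simpa [hu] using hvu hj
        simp only [this, if_true]
        ring
      rw [h1, mul_assoc, Finset.prod_ite_zero, Finset.prod_ite_zero]
      congr 1
      have hiff : z = v.piecewise i (fun j => min (i j + 1) n)
          ↔ (∀ j ∈ v, z j = i j) ∧ ∀ j ∈ Finset.univ \ v, z j = min (i j + 1) n := by
        constructor
        · intro h
          subst h
          refine ⟨fun j hj => by simp [hj], fun j hj => ?_⟩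
          have : j ∉ v := (Finset.mem_sdiff.1 hj).2
          simp [this]
        · rintro ⟨h1, h2⟩
          funext j
          by_cases hj : j ∈ v
          · simp [hj, h1 j hj]
          · simp [hj, h2 j (by simp [hj])]
      by_cases h : z = v.piecewise i (fun j => min (i j + 1) n)
      · rw [if_pos h, if_pos (hiff.1 h).1, if_pos (hiff.1 h).2]
        simp
      · rw [if_neg h]
        by_cases h1 : ∀ j ∈ v, z j = i j
        · rw [if_neg fun h2 => h (hiff.2 ⟨h1, h2⟩), mul_zero]
        · rw [if_neg h1, zero_mul]
  simp_rw [hexp, Finset.mul_sum]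
  rw [Finset.sum_comm, mixedDiff]
  refine Finset.sum_congr rfl fun v _ => ?_
  rw [Finset.sum_eq_single (v.piecewise i (fun j => min (i j + 1) n))]
  · have : gridPt a b n (v.piecewise i fun j => min (i j + 1) n)
        = v.piecewise (gridPt a b n i) (gridPt a b n fun j => min (i j + 1) n) := by
      funext j
      by_cases hj : j ∈ v <;> simp [gridPt, hj]
    rw [this]
    simp [mul_comm]
  · intro z _ hz
    simp [hz]
  · intro h
    refine (h (Fintype.mem_piFinset.2 fun j => ?_)).elim
    have := hi j
    by_cases hj : j ∈ v
    · simp [hj]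
      omega
    · simp [hj]

/-- Expansion of the step function that approximates `f` from the upper grid points. -/
lemma apply_gridCeil_eq_sum {s : ℕ} {a b : Fin s → ℝ} (hab : ∀ j, a j < b j) {n : ℕ}
    (hn : 0 < n) (f : (Fin s → ℝ) → ℝ) {x : Fin s → ℝ} (hx : x ∈ Set.Icc a b) :
    f (gridPt a b n (gridCeil a b n x))
      = ∑ i ∈ Fintype.piFinset fun _ : Fin s => Finset.range (n + 1),
        mixedDiff (gridPt a b n i) (gridPt a b n fun j => min (i j + 1) n)
          (Finset.univ.filter fun j => i j < n) f
        * ∏ j, stepFun n (i j) (x j ≤ gridPt a b n i j) := by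
  classical
  have h1 : ∀ i ∈ Fintype.piFinset fun _ : Fin s => Finset.range (n + 1),
      mixedDiff (gridPt a b n i) (gridPt a b n fun j => min (i j + 1) n)
          (Finset.univ.filter fun j => i j < n) f
        * ∏ j, stepFun n (i j) (x j ≤ gridPt a b n i j)
      = ∑ z ∈ Fintype.piFinset fun _ : Fin s => Finset.range (n + 1), f (gridPt a b n z)
        * ∏ j, (diffCoeff n (i j) (z j) * stepFun n (i j) (gridCeil a b n x j ≤ i j)) := by
    intro i hi
    rw [← sum_prod_diffCoeff a b n f i (fun j => by
      have := Fintype.mem_piFinset.1 hi j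
      simp only [Finset.mem_range] at this
      omega), Finset.sum_mul]
    refine Finset.sum_congr rfl fun z _ => ?_
    rw [mul_assoc, Finset.prod_mul_distrib]
    congr 2
    refine Finset.prod_congr rfl fun j _ => ?_
    simp only [stepFun, gridCeil_le_iff hab hn]
  rw [Finset.sum_congr rfl h1, Finset.sum_comm]
  have h2 : ∀ z ∈ Fintype.piFinset fun _ : Fin s => Finset.range (n + 1),
      ∑ i ∈ Fintype.piFinset fun _ : Fin s => Finset.range (n + 1), f (gridPt a b n z)
        * ∏ j, (diffCoeff n (i j) (z j) * stepFun n (i j) (gridCeil a b n x j ≤ i j))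
      = if z = gridCeil a b n x then f (gridPt a b n z) else 0 := by
    intro z hz
    rw [← Finset.mul_sum, ← Finset.prod_univ_sum (f := fun j k =>
      diffCoeff n k (z j) * stepFun n k (gridCeil a b n x j ≤ k)),
      Finset.prod_congr rfl fun j _ => sum_diffCoeff_mul_stepFun (by
        have := Fintype.mem_piFinset.1 hz j
        simp only [Finset.mem_range] at this
        omega) (gridCeil_le hab hn hx j), Finset.prod_ite_zero]
    simp [funext_iff]
  rw [Finset.sum_congr rfl h2, Finset.sum_ite_eq', if_pos]
  exact Fintype.mem_piFinset.2 fun j => by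
    have := gridCeil_le hab hn hx j
    simp only [Finset.mem_range]
    omega

/-- A direction with `i j = n` carries the constant `1`, so only the directions in which a
difference is taken leave an indicator. -/
lemma prod_stepFun {s : ℕ} (n : ℕ) (i : Fin s → ℕ) (hi : ∀ j, i j ≤ n) (τ x : Fin s → ℝ) :
    ∏ j, stepFun n (i j) (x j ≤ τ j) = (-1) ^ (Finset.univ.filter fun j => i j < n).card
      * ∏ j ∈ Finset.univ.filter fun j => i j < n, (Set.Iic (τ j)).indicator (1 : ℝ → ℝ) (x j) := by
  rw [← Finset.prod_const, ← Finset.prod_mul_distrib, Finset.prod_filter]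
  refine Finset.prod_congr rfl fun j _ => ?_
  have := hi j
  rcases this.lt_or_eq with h | h
  · simp [stepFun, h, h.ne, Set.indicator_apply]
  · simp [stepFun, h]

/-- This number cancels the factor `n ^ (-|u|)` in the bound for a mixed difference over a grid
cell, which makes the final estimate independent of `n`. -/
lemma card_filter_multiIndex {s : ℕ} (n : ℕ) (u : Finset (Fin s)) :
    ((Fintype.piFinset fun _ : Fin s => Finset.range (n + 1)).filter
      fun i => (Finset.univ.filter fun j => i j < n) = u).card = n ^ u.card := by
  classical
  have : ((Fintype.piFinset fun _ : Fin s => Finset.range (n + 1)).filter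
      fun i => (Finset.univ.filter fun j => i j < n) = u)
      = Fintype.piFinset fun j => if j ∈ u then Finset.range n else {n} := by
    ext i
    simp only [Finset.mem_filter, Fintype.mem_piFinset, Finset.mem_range, Finset.ext_iff,
      Finset.mem_univ, true_and]
    rw [← forall_and]
    refine forall_congr' fun j => ?_
    by_cases hj : j ∈ u
    · simp only [hj, iff_true, if_true, Finset.mem_range]
      omega
    · simp only [hj, iff_false, if_false, Finset.mem_singleton]
      omega
  rw [this, Fintype.card_piFinset, ← Finset.prod_subset (Finset.subset_univ u)]
  · rw [Finset.prod_congr rfl (g := fun _ => n) (fun j hj => by simp [hj]), Finset.prod_const]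
  · intro j _ hj
    simp [hj]

/-- A Koksma-Hlawka inequality that only uses bounds on the mixed partial derivatives. -/
theorem koksma_hlawka {s : ℕ} {a b : Fin s → ℝ} (hab : ∀ j, a j < b j)
    {f : (Fin s → ℝ) → ℝ} (hf : HasMixedPartials a b f) {M : Finset (Fin s) → ℝ}
    (hM : ∀ u, ∀ x ∈ Set.Icc a b, |mixedPartial a b u f x| ≤ M u)
    (μ : Measure (Fin s → ℝ)) [IsProbabilityMeasure μ] (hμ : ∀ᵐ x ∂μ, x ∈ Set.Icc a b)
    {R : ℕ} (hR : 0 < R) (X : ℕ → Fin s → ℝ) (hX : ∀ k, X k ∈ Set.Icc a b)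
    (Δ : Finset (Fin s) → ℝ)
    (hΔ : ∀ u : Finset (Fin s), u.Nonempty → ∀ τ ∈ Set.Icc a b,
      |(∫ x, ∏ j ∈ u, (Set.Iic (τ j)).indicator (1 : ℝ → ℝ) (x j) ∂μ)
        - (∑ k ∈ Finset.range R, ∏ j ∈ u, (Set.Iic (τ j)).indicator (1 : ℝ → ℝ) (X k j)) / R|
        ≤ Δ u) :
    |(∫ x, f x ∂μ) - (∑ k ∈ Finset.range R, f (X k)) / R|
      ≤ ∑ u ∈ Finset.univ.filter (fun u : Finset (Fin s) => u.Nonempty),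
        M u * (∏ j ∈ u, (b j - a j)) * Δ u := by
  classical
  have hRpos : (0 : ℝ) < R := by exact_mod_cast hR
  have hMnn : ∀ u, 0 ≤ M u := fun u =>
    (abs_nonneg _).trans (hM u a ⟨le_rfl, fun j => (hab j).le⟩)
  set B := ∑ u ∈ Finset.univ.filter (fun u : Finset (Fin s) => u.Nonempty),
        M u * (∏ j ∈ u, (b j - a j)) * Δ u with hB
  set K := ∑ j, M {j} * (b j - a j) with hK
  have hfcont := hf.continuousOn (M := fun j => M {j}) fun j => hM {j}
  have hμr : μ.restrict (Set.Icc a b) = μ := Measure.restrict_eq_self_of_ae_mem hμ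
  have hfm : AEStronglyMeasurable f μ := by
    have := hfcont.aestronglyMeasurable (μ := μ) measurableSet_Icc
    rwa [hμr] at this
  have hfint : Integrable f μ := by
    refine Integrable.of_bound hfm (M ∅) ?_
    filter_upwards [hμ] with x hx
    simpa [mixedPartial_empty] using hM ∅ x hx
  have key : ∀ n : ℕ, 0 < n →
      |(∫ x, f x ∂μ) - (∑ k ∈ Finset.range R, f (X k)) / R| ≤ B + 2 * K / n := by
    intro n hn
    have hn' : (0 : ℝ) < n := by exact_mod_cast hn
    set I := Fintype.piFinset fun _ : Fin s => Finset.range (n + 1) with hI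
    have hIle : ∀ i ∈ I, ∀ j, i j ≤ n := fun i hi j => by
      have := Fintype.mem_piFinset.1 hi j
      simp only [Finset.mem_range] at this
      omega
    let U : (Fin s → ℕ) → Finset (Fin s) := fun i => Finset.univ.filter fun j => i j < n
    let D : (Fin s → ℕ) → ℝ := fun i =>
      mixedDiff (gridPt a b n i) (gridPt a b n fun j => min (i j + 1) n) (U i) f
    let χ : (Fin s → ℕ) → (Fin s → ℝ) → ℝ := fun i x =>
      ∏ j ∈ U i, (Set.Iic (gridPt a b n i j)).indicator (1 : ℝ → ℝ) (x j)
    let g : (Fin s → ℝ) → ℝ := fun x => ∑ i ∈ I, D i * ((-1) ^ (U i).card * χ i x)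
    -- `g` is the step function that takes the value of `f` at the upper vertex of the grid cell.
    have hg : ∀ x ∈ Set.Icc a b, |f x - g x| ≤ K / n := by
      intro x hx
      have h1 : g x = f (gridPt a b n (gridCeil a b n x)) := by
        rw [apply_gridCeil_eq_sum hab hn f hx]
        refine Finset.sum_congr rfl fun i hi => ?_
        rw [prod_stepFun n i (hIle i hi)]
      rw [h1]
      refine (hf.abs_sub_le (M := fun j => M {j}) (fun j => hM {j}) hx
        (gridPt_mem_Icc hab hn (gridCeil_le hab hn hx))).trans ?_
      rw [hK, Finset.sum_div]
      refine Finset.sum_le_sum fun j _ => ?_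
      rw [mul_div_assoc]
      exact mul_le_mul_of_nonneg_left (abs_gridPt_gridCeil_sub_le hab hn hx j) (hMnn _)
    have hχm : ∀ i, Measurable (χ i) := fun i =>
      Finset.measurable_fun_prod _ fun j _ =>
        (measurable_one.indicator measurableSet_Iic).comp (measurable_pi_apply j)
    have hχ1 : ∀ i x, ‖χ i x‖ ≤ 1 := by
      intro i x
      rw [Real.norm_eq_abs, Finset.abs_prod]
      refine Finset.prod_le_one (fun j _ => abs_nonneg _) fun j _ => ?_
      rw [Set.indicator_apply]
      split_ifs <;> simp
    have hχint : ∀ i, Integrable (χ i) μ := fun i =>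
      Integrable.of_bound (hχm i).aestronglyMeasurable 1 (Filter.Eventually.of_forall (hχ1 i))
    have hgint : Integrable g μ :=
      integrable_finsetSum _ fun i _ => ((hχint i).const_mul _).const_mul _
    have hgΛ : (∫ x, g x ∂μ) - (∑ k ∈ Finset.range R, g (X k)) / R
        = ∑ i ∈ I, D i * ((-1) ^ (U i).card *
          ((∫ x, χ i x ∂μ) - (∑ k ∈ Finset.range R, χ i (X k)) / R)) := by
      have h1 : ∫ x, g x ∂μ = ∑ i ∈ I, D i * ((-1) ^ (U i).card * ∫ x, χ i x ∂μ) := by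
        rw [integral_finsetSum _ fun i _ => ((hχint i).const_mul _).const_mul _]
        refine Finset.sum_congr rfl fun i _ => ?_
        rw [integral_const_mul, integral_const_mul]
      have h2 : (∑ k ∈ Finset.range R, g (X k)) / R = ∑ i ∈ I, D i * ((-1) ^ (U i).card *
          ((∑ k ∈ Finset.range R, χ i (X k)) / R)) := by
        rw [Finset.sum_comm, Finset.sum_div]
        refine Finset.sum_congr rfl fun i _ => ?_
        rw [← Finset.mul_sum, ← Finset.mul_sum, mul_div_assoc, mul_div_assoc]
      rw [h1, h2, ← Finset.sum_sub_distrib]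
      refine Finset.sum_congr rfl fun i _ => ?_
      ring
    have hD : ∀ i ∈ I, |D i| ≤ M (U i) * ((∏ j ∈ U i, (b j - a j)) / n ^ (U i).card) := by
      intro i hi
      refine (hf.abs_mixedDiff_le (U i) (gridPt_mem_Icc hab hn (hIle i hi))
        (gridPt_mem_Icc hab hn fun j => min_le_right _ _) (hM (U i))).trans ?_
      refine mul_le_mul_of_nonneg_left (le_of_eq ?_) (hMnn _)
      rw [← Finset.prod_const, ← Finset.prod_div_distrib]
      refine Finset.prod_congr rfl fun j hj => ?_
      have hij : i j < n := by simpa [U] using hj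
      have : min (i j + 1) n = i j + 1 := by omega
      have hb : 0 < b j - a j := sub_pos.2 (hab j)
      simp only [gridPt, this]
      push_cast
      rw [show a j + (b j - a j) * ((i j + 1) / n) - (a j + (b j - a j) * (i j / n))
        = (b j - a j) / n by ring]
      exact abs_of_pos (by positivity)
    -- The empty set contributes nothing: its test function is constant, and integral and sample
    -- mean agree on constants.
    let E : Finset (Fin s) → ℝ := fun u =>
      if u.Nonempty then M u * ((∏ j ∈ u, (b j - a j)) / n ^ u.card) * Δ u else 0
    have hterm : ∀ i ∈ I, |D i * ((-1) ^ (U i).card *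
          ((∫ x, χ i x ∂μ) - (∑ k ∈ Finset.range R, χ i (X k)) / R))| ≤ E (U i) := by
      intro i hi
      by_cases hu : (U i).Nonempty
      · simp only [E, hu, if_true]
        rw [abs_mul, abs_mul, abs_pow, abs_neg, abs_one, one_pow, one_mul]
        exact mul_le_mul (hD i hi) (hΔ (U i) hu _ (gridPt_mem_Icc hab hn (hIle i hi)))
          (abs_nonneg _) ((abs_nonneg _).trans (hD i hi))
      · have h0 : U i = ∅ := Finset.not_nonempty_iff_eq_empty.1 hu
        have h1 : ∀ x, χ i x = 1 := fun x => by simp only [χ, h0, Finset.prod_empty]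
        simp only [E, hu, if_false, h1]
        simp [hRpos.ne']
    have hgB : |(∫ x, g x ∂μ) - (∑ k ∈ Finset.range R, g (X k)) / R| ≤ B := by
      rw [hgΛ]
      refine (Finset.abs_sum_le_sum_abs _ _).trans ((Finset.sum_le_sum hterm).trans (le_of_eq ?_))
      rw [← Finset.sum_fiberwise_of_maps_to (t := Finset.univ) (g := U)
        (fun _ _ => Finset.mem_univ _)]
      rw [hB, Finset.sum_filter]
      refine Finset.sum_congr rfl fun u _ => ?_
      rw [Finset.sum_congr rfl (g := fun _ => E u) fun i hi => by
        rw [(Finset.mem_filter.1 hi).2], Finset.sum_const, card_filter_multiIndex, nsmul_eq_mul]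
      by_cases hu : u.Nonempty
      · simp only [E, hu, if_true]
        push_cast
        field_simp
      · simp [E, hu]
    have h1 : |(∫ x, f x ∂μ) - ∫ x, g x ∂μ| ≤ K / n := by
      rw [← integral_sub hfint hgint]
      have := norm_integral_le_of_norm_le_const (μ := μ) (f := fun x => f x - g x) (C := K / n)
        (by
          filter_upwards [hμ] with x hx
          exact hg x hx)
      simpa using this
    have h2 : |(∑ k ∈ Finset.range R, f (X k)) / R - (∑ k ∈ Finset.range R, g (X k)) / R|
        ≤ K / n := by
      rw [← sub_div, ← Finset.sum_sub_distrib, abs_div, abs_of_pos hRpos, div_le_iff₀ hRpos]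
      refine (Finset.abs_sum_le_sum_abs _ _).trans
        ((Finset.sum_le_sum fun k _ => hg _ (hX k)).trans (le_of_eq ?_))
      simp [mul_comm]
    have h3 : 2 * K / n = K / n + K / n := by ring
    rw [h3]
    rw [abs_le] at h1 h2 hgB ⊢
    constructor <;> linarith [h1.1, h1.2, h2.1, h2.2, hgB.1, hgB.2]
  -- Only the distance from `f` to the step function depends on `n`; it vanishes in the limit.
  have hlim : Filter.Tendsto (fun n : ℕ => B + 2 * K / n) Filter.atTop (nhds (B + 0)) :=
    tendsto_const_nhds.add (tendsto_const_div_atTop_nhds_zero_nat _)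
  rw [add_zero] at hlim
  refine ge_of_tendsto hlim ?_
  filter_upwards [Filter.eventually_gt_atTop 0] with n hn
  exact key n hn

/-! ### Hat functions -/

namespace TensorGrid

variable {s : ℕ} {a b : Fin s → ℝ} (𝒢 : TensorGrid a b)

lemma node_strict (j : Fin s) {i k : ℕ} (hik : i < k) (hk : k ≤ 𝒢.K j) :
    𝒢.node j i < 𝒢.node j k := by
  induction k, hik using Nat.le_induction with
  | base => exact 𝒢.node_lt j i (by omega)
  | succ k hik ih => exact (ih (by omega)).trans (𝒢.node_lt j k (by omega))

lemma node_mono (j : Fin s) {i k : ℕ} (hik : i ≤ k) (hk : k ≤ 𝒢.K j) :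
    𝒢.node j i ≤ 𝒢.node j k := by
  rcases hik.lt_or_eq with h | rfl
  · exact (𝒢.node_strict j h hk).le
  · exact le_rfl

lemma node_mem_Icc (j : Fin s) {k : ℕ} (hk : k ≤ 𝒢.K j) :
    𝒢.node j k ∈ Set.Icc (a j) (b j) := by
  rw [← 𝒢.node_zero j, ← 𝒢.node_last j]
  exact ⟨𝒢.node_mono j (Nat.zero_le _) hk, 𝒢.node_mono j hk le_rfl⟩

lemma left_lt_right {s : ℕ} {a b : Fin s → ℝ} (𝒢 : TensorGrid a b) (j : Fin s) : a j < b j := by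
  rw [← 𝒢.node_zero j, ← 𝒢.node_last j]
  exact 𝒢.node_strict j (𝒢.K_pos j) le_rfl

/-- At `x = node j i` the rising branch of `hat` may take precedence; both branches give `1` there.
-/
lemma hat_left (j : Fin s) {i : ℕ} (hi : i < 𝒢.K j) {x : ℝ}
    (hx : x ∈ Set.Icc (𝒢.node j i) (𝒢.node j (i + 1))) :
    𝒢.hat j i x = (𝒢.node j (i + 1) - x) / (𝒢.node j (i + 1) - 𝒢.node j i) := by
  have h1 := 𝒢.node_lt j i hi
  unfold hat
  split_ifs with h h'
  · have h2 := 𝒢.node_strict j (show i - 1 < i by omega) hi.le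
    have : x = 𝒢.node j i := le_antisymm h.2.2 hx.1
    rw [this, div_self (sub_pos.2 h2).ne', div_self (sub_pos.2 h1).ne']
  · rfl
  · exact (h' ⟨hi, hx.1, hx.2⟩).elim

lemma hat_right (j : Fin s) {i : ℕ} {x : ℝ}
    (hx : x ∈ Set.Icc (𝒢.node j i) (𝒢.node j (i + 1))) :
    𝒢.hat j (i + 1) x = (x - 𝒢.node j i) / (𝒢.node j (i + 1) - 𝒢.node j i) := by
  unfold hat
  rw [if_pos ⟨by omega, by simpa using hx.1, hx.2⟩]
  simp

lemma hat_eq_zero (j : Fin s) {i k : ℕ} (hi : i < 𝒢.K j) (hk : k ≤ 𝒢.K j) (hik : k ≠ i)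
    (hik' : k ≠ i + 1) {x : ℝ} (hx : x ∈ Set.Icc (𝒢.node j i) (𝒢.node j (i + 1))) :
    𝒢.hat j k x = 0 := by
  unfold hat
  split_ifs with h h'
  · rcases lt_or_gt_of_ne hik with hlt | hgt
    · exact absurd (𝒢.node_strict j hlt hi.le) (not_lt.2 (hx.1.trans h.2.2))
    · have := 𝒢.node_mono j (show i + 1 ≤ k - 1 by omega) (by omega)
      have : x = 𝒢.node j (k - 1) := le_antisymm (hx.2.trans this) h.2.1
      simp [this]
  · rcases lt_or_gt_of_ne hik with hlt | hgt
    · have := 𝒢.node_mono j (show k + 1 ≤ i by omega) hi.le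
      have : x = 𝒢.node j (k + 1) := le_antisymm h'.2.2 (this.trans hx.1)
      simp [this]
    · exact absurd (𝒢.node_strict j (show i + 1 < k by omega) hk)
        (not_lt.2 (h'.2.1.trans hx.2))
  · rfl

lemma hat_nonneg (j : Fin s) {k : ℕ} (hk : k ≤ 𝒢.K j) (x : ℝ) : 0 ≤ 𝒢.hat j k x := by
  unfold hat
  split_ifs with h h'
  · have := 𝒢.node_strict j (show k - 1 < k by omega) hk
    exact div_nonneg (sub_nonneg.2 h.2.1) (sub_nonneg.2 this.le)
  · have := 𝒢.node_lt j k (by omega)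
    exact div_nonneg (sub_nonneg.2 h'.2.2) (sub_nonneg.2 this.le)
  · exact le_rfl

lemma hat_le_one (j : Fin s) {k : ℕ} (hk : k ≤ 𝒢.K j) (x : ℝ) : 𝒢.hat j k x ≤ 1 := by
  unfold hat
  split_ifs with h h'
  · have := 𝒢.node_strict j (show k - 1 < k by omega) hk
    rw [div_le_one (sub_pos.2 this)]
    linarith [h.2.2]
  · have := 𝒢.node_lt j k (by omega)
    rw [div_le_one (sub_pos.2 this)]
    linarith [h'.2.1]
  · exact zero_le_one

lemma measurable_hat (j : Fin s) (k : ℕ) : Measurable (𝒢.hat j k) := by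
  unfold hat
  refine Measurable.ite ?_ (by fun_prop) (Measurable.ite ?_ (by fun_prop) measurable_const)
  · exact (MeasurableSet.const _).inter measurableSet_Icc
  · exact (MeasurableSet.const _).inter measurableSet_Icc

lemma exists_cell (j : Fin s) {x : ℝ} (hx : x ∈ Set.Icc (a j) (b j)) :
    ∃ i < 𝒢.K j, x ∈ Set.Icc (𝒢.node j i) (𝒢.node j (i + 1)) := by
  have key : ∀ n, 1 ≤ n → n ≤ 𝒢.K j → x ≤ 𝒢.node j n →
      ∃ i < 𝒢.K j, x ∈ Set.Icc (𝒢.node j i) (𝒢.node j (i + 1)) := by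
    intro n hn
    induction n, hn using Nat.le_induction with
    | base => exact fun h1 hx1 => ⟨0, h1, by rw [𝒢.node_zero]; exact hx.1, hx1⟩
    | succ n hn ih =>
      intro h1 hx1
      rcases le_total x (𝒢.node j n) with h | h
      · exact ih (by omega) h
      · exact ⟨n, by omega, h, hx1⟩
  exact key (𝒢.K j) (𝒢.K_pos j) le_rfl (by rw [𝒢.node_last]; exact hx.2)

lemma sum_hat (j : Fin s) {x : ℝ} (hx : x ∈ Set.Icc (a j) (b j)) :
    ∑ k : Fin (𝒢.K j + 1), 𝒢.hat j k x = 1 := by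
  obtain ⟨i, hi, hxi⟩ := 𝒢.exists_cell j hx
  have h1 := 𝒢.node_lt j i hi
  rw [Fin.sum_univ_eq_sum_range (fun k => 𝒢.hat j k x),
    ← Finset.sum_subset (s₁ := {i, i + 1}) (by
      intro k hk
      simp only [Finset.mem_insert, Finset.mem_singleton, Finset.mem_range] at hk ⊢
      omega) (by
      intro k hk hk'
      simp only [Finset.mem_insert, Finset.mem_singleton, Finset.mem_range, not_or] at hk hk'
      exact 𝒢.hat_eq_zero j hi (by omega) hk'.1 hk'.2 hxi),
    Finset.sum_pair (by omega), 𝒢.hat_left j hi hxi, 𝒢.hat_right j hxi, ← add_div]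
  rw [div_eq_one_iff_eq (sub_pos.2 h1).ne']
  ring

lemma intervalIntegrable_hat (j : Fin s) {k : ℕ} (hk : k ≤ 𝒢.K j) (x y : ℝ) :
    IntervalIntegrable (𝒢.hat j k) volume x y := by
  rw [intervalIntegrable_iff]
  refine IntegrableOn.of_bound (by simp [Set.uIoc]) (𝒢.measurable_hat j k).aestronglyMeasurable 1
    (Filter.Eventually.of_forall fun x => ?_)
  rw [Real.norm_of_nonneg (𝒢.hat_nonneg j hk x)]
  exact 𝒢.hat_le_one j hk x

lemma integral_hat_cell (j : Fin s) {i k : ℕ} (hi : i < 𝒢.K j) (hk : k ≤ 𝒢.K j) :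
    ∫ x in (𝒢.node j i)..(𝒢.node j (i + 1)), 𝒢.hat j k x
      = if k = i ∨ k = i + 1 then (𝒢.node j (i + 1) - 𝒢.node j i) / 2 else 0 := by
  have h1 := 𝒢.node_lt j i hi
  have h2 : 𝒢.node j (i + 1) - 𝒢.node j i ≠ 0 := (sub_pos.2 h1).ne'
  split_ifs with h
  · rcases h with rfl | rfl
    · rw [intervalIntegral.integral_congr (g := fun x =>
        (𝒢.node j (k + 1) - x) / (𝒢.node j (k + 1) - 𝒢.node j k)) (fun x hx => by
          rw [Set.uIcc_of_le h1.le] at hx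
          exact 𝒢.hat_left j hi hx), intervalIntegral.integral_div,
        intervalIntegral.integral_sub (by simp) (by simp), integral_id,
        intervalIntegral.integral_const, smul_eq_mul, div_eq_iff h2]
      ring
    · rw [intervalIntegral.integral_congr (g := fun x =>
        (x - 𝒢.node j i) / (𝒢.node j (i + 1) - 𝒢.node j i)) (fun x hx => by
          rw [Set.uIcc_of_le h1.le] at hx
          exact 𝒢.hat_right j hx), intervalIntegral.integral_div,
        intervalIntegral.integral_sub (by simp) (by simp), integral_id,
        intervalIntegral.integral_const, smul_eq_mul, div_eq_iff h2]
      ring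
  · push Not at h
    rw [intervalIntegral.integral_congr (g := fun _ => 0) (fun x hx => by
          rw [Set.uIcc_of_le h1.le] at hx
          exact 𝒢.hat_eq_zero j hi hk h.1 h.2 hx)]
    simp

lemma hatConst_pos (j : Fin s) {k : ℕ} (hk : k ≤ 𝒢.K j) : 0 < 𝒢.hatConst j k := by
  have hK := 𝒢.K_pos j
  unfold hatConst
  split_ifs with h h'
  · have := 𝒢.node_strict j (show 0 < 1 by omega) hK
    rw [𝒢.node_zero] at this
    exact div_pos two_pos (sub_pos.2 this)
  · have := 𝒢.node_strict j (show 𝒢.K j - 1 < 𝒢.K j by omega) le_rfl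
    rw [𝒢.node_last] at this
    exact div_pos two_pos (sub_pos.2 this)
  · have := 𝒢.node_strict j (show k - 1 < k + 1 by omega) (by omega)
    exact div_pos two_pos (sub_pos.2 this)

lemma integral_hat (j : Fin s) {k : ℕ} (hk : k ≤ 𝒢.K j) :
    ∫ x in (a j)..(b j), 𝒢.hat j k x = (𝒢.hatConst j k)⁻¹ := by
  have hK := 𝒢.K_pos j
  have hsum := intervalIntegral.sum_integral_adjacent_intervals (μ := volume) (f := 𝒢.hat j k)
    (a := 𝒢.node j) (n := 𝒢.K j) fun i _ => 𝒢.intervalIntegrable_hat j hk _ _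
  rw [𝒢.node_zero, 𝒢.node_last] at hsum
  rw [← hsum, Finset.sum_congr rfl fun i hi =>
    𝒢.integral_hat_cell j (Finset.mem_range.1 hi) hk]
  unfold hatConst
  split_ifs with h h'
  · subst h
    rw [Finset.sum_eq_single 0 (fun i _ hi => if_neg (by omega))
      (fun h => (h (Finset.mem_range.2 hK)).elim), 𝒢.node_zero]
    simp
  · subst h'
    rw [Finset.sum_eq_single (𝒢.K j - 1)
      (fun i hi hi' => if_neg (by have := Finset.mem_range.1 hi; omega))
      (fun h => (h (Finset.mem_range.2 (by omega))).elim), if_pos (by omega),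
      show 𝒢.K j - 1 + 1 = 𝒢.K j by omega, 𝒢.node_last]
    simp
  · rw [← Finset.sum_subset (s₁ := {k - 1, k}) (by
      intro i hi
      simp only [Finset.mem_insert, Finset.mem_singleton, Finset.mem_range] at hi ⊢
      omega) (by
      intro i _ hi
      simp only [Finset.mem_insert, Finset.mem_singleton, not_or] at hi
      exact if_neg (by omega)), Finset.sum_pair (by omega), if_pos (by omega),
      if_pos (by omega), show k - 1 + 1 = k by omega, inv_div]
    ring

/-- The normalized hat functions. -/
noncomputable def hatDensity (j : Fin s) (k : ℕ) (x : ℝ) : ℝ := 𝒢.hatConst j k * 𝒢.hat j k x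

lemma hatDensity_nonneg (j : Fin s) {k : ℕ} (hk : k ≤ 𝒢.K j) (x : ℝ) :
    0 ≤ 𝒢.hatDensity j k x :=
  mul_nonneg (𝒢.hatConst_pos j hk).le (𝒢.hat_nonneg j hk x)

lemma measurable_hatDensity (j : Fin s) (k : ℕ) : Measurable (𝒢.hatDensity j k) :=
  (𝒢.measurable_hat j k).const_mul _

lemma intervalIntegrable_hatDensity (j : Fin s) {k : ℕ} (hk : k ≤ 𝒢.K j) (x y : ℝ) :
    IntervalIntegrable (𝒢.hatDensity j k) volume x y :=
  (𝒢.intervalIntegrable_hat j hk x y).const_mul _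

lemma hatCDF_right (j : Fin s) {k : ℕ} (hk : k ≤ 𝒢.K j) : 𝒢.hatCDF j k (b j) = 1 := by
  unfold hatCDF
  rw [intervalIntegral.integral_const_mul, 𝒢.integral_hat j hk,
    mul_inv_cancel₀ (𝒢.hatConst_pos j hk).ne']

lemma hatCDF_mono (j : Fin s) {k : ℕ} (hk : k ≤ 𝒢.K j) {x y : ℝ} (hxy : x ≤ y) :
    𝒢.hatCDF j k x ≤ 𝒢.hatCDF j k y := by
  rw [← sub_nonneg]
  change 0 ≤ (∫ τ in (a j)..y, 𝒢.hatDensity j k τ) - ∫ τ in (a j)..x, 𝒢.hatDensity j k τ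
  rw [intervalIntegral.integral_interval_sub_left (𝒢.intervalIntegrable_hatDensity j hk _ _)
    (𝒢.intervalIntegrable_hatDensity j hk _ _)]
  exact intervalIntegral.integral_nonneg hxy fun u _ => 𝒢.hatDensity_nonneg j hk u

lemma hatCDF_nonneg (j : Fin s) {k : ℕ} (hk : k ≤ 𝒢.K j) {x : ℝ} (hx : a j ≤ x) :
    0 ≤ 𝒢.hatCDF j k x := by
  have := 𝒢.hatCDF_mono j hk hx
  rwa [hatCDF, intervalIntegral.integral_same] at this

lemma hatCDF_le_one (j : Fin s) {k : ℕ} (hk : k ≤ 𝒢.K j) {x : ℝ} (hx : x ≤ b j) :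
    𝒢.hatCDF j k x ≤ 1 :=
  (𝒢.hatCDF_mono j hk hx).trans (𝒢.hatCDF_right j hk).le

lemma setIntegral_indicator_mul_hatDensity (j : Fin s) (k : ℕ) {τ : ℝ}
    (hτ : τ ∈ Set.Icc (a j) (b j)) :
    ∫ x in Set.Icc (a j) (b j), (Set.Iic τ).indicator (1 : ℝ → ℝ) x * 𝒢.hatDensity j k x
      = 𝒢.hatCDF j k τ := by
  have h1 : ∀ x, (Set.Iic τ).indicator (1 : ℝ → ℝ) x * 𝒢.hatDensity j k x
      = (Set.Iic τ).indicator (𝒢.hatDensity j k) x := fun x => by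
    by_cases hx : x ∈ Set.Iic τ <;> simp [hx]
  have hset : Set.Icc (a j) (b j) ∩ Set.Iic τ = Set.Icc (a j) τ := by
    ext x
    simp only [Set.mem_inter_iff, Set.mem_Icc, Set.mem_Iic]
    exact ⟨fun h => ⟨h.1.1, h.2⟩, fun h => ⟨⟨h.1, h.2.trans hτ.2⟩, h.2⟩⟩
  simp_rw [h1]
  rw [setIntegral_indicator measurableSet_Iic, hset,
    integral_Icc_eq_integral_Ioc, ← intervalIntegral.integral_of_le hτ.1]
  rfl

lemma setIntegral_hatDensity (j : Fin s) {k : ℕ} (hk : k ≤ 𝒢.K j) :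
    ∫ x in Set.Icc (a j) (b j), 𝒢.hatDensity j k x = 1 := by
  rw [integral_Icc_eq_integral_Ioc, ← intervalIntegral.integral_of_le (𝒢.left_lt_right j).le]
  exact 𝒢.hatCDF_right j hk

end TensorGrid

lemma setIntegral_Icc_prod {s : ℕ} (a b : Fin s → ℝ) (g : Fin s → ℝ → ℝ) :
    ∫ x in Set.Icc a b, ∏ j, g j (x j) = ∏ j, ∫ x in Set.Icc (a j) (b j), g j x := by
  rw [← Set.pi_univ_Icc, volume_pi, Measure.restrict_pi_pi, integral_fintype_prod_eq_prod]

/-! ### Product hat distributions and quadrature for one of them -/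

namespace TensorGrid

variable {s : ℕ} {a b : Fin s → ℝ} (𝒢 : TensorGrid a b)

/-- The density of the distribution with index `k`. -/
noncomputable def prodDensity (k : 𝒢.Index) (x : Fin s → ℝ) : ℝ := ∏ j, 𝒢.hatDensity j (k j) (x j)

lemma prodDensity_nonneg (k : 𝒢.Index) (x : Fin s → ℝ) : 0 ≤ 𝒢.prodDensity k x :=
  Finset.prod_nonneg fun j _ => 𝒢.hatDensity_nonneg j (Nat.le_of_lt_succ (k j).2) _

lemma measurable_prodDensity (k : 𝒢.Index) : Measurable (𝒢.prodDensity k) :=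
  Finset.measurable_fun_prod _ fun j _ =>
    (𝒢.measurable_hatDensity j (k j)).comp (measurable_pi_apply j)

lemma setIntegral_prodDensity (k : 𝒢.Index) : ∫ x in Set.Icc a b, 𝒢.prodDensity k x = 1 := by
  unfold prodDensity
  rw [setIntegral_Icc_prod]
  exact Finset.prod_eq_one fun j _ => 𝒢.setIntegral_hatDensity j (Nat.le_of_lt_succ (k j).2)

/-- The integral of a non-integrable function is `0` by convention, so the value `1` forces
integrability. -/
lemma integrableOn_prodDensity (k : 𝒢.Index) : IntegrableOn (𝒢.prodDensity k) (Set.Icc a b) := by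
  by_contra h
  have := 𝒢.setIntegral_prodDensity k
  rw [integral_undef h] at this
  exact zero_ne_one this

/-- The distribution with index `k`. -/
noncomputable def mixtureMeasure (k : 𝒢.Index) : Measure (Fin s → ℝ) :=
  (volume.restrict (Set.Icc a b)).withDensity fun x => ENNReal.ofReal (𝒢.prodDensity k x)

instance (k : 𝒢.Index) : IsProbabilityMeasure (𝒢.mixtureMeasure k) := by
  constructor
  rw [mixtureMeasure, withDensity_apply _ MeasurableSet.univ, Measure.restrict_univ,
    ← ofReal_integral_eq_lintegral_ofReal (𝒢.integrableOn_prodDensity k)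
      (Filter.Eventually.of_forall (𝒢.prodDensity_nonneg k)), 𝒢.setIntegral_prodDensity,
    ENNReal.ofReal_one]

lemma ae_mem_Icc_mixtureMeasure (k : 𝒢.Index) :
    ∀ᵐ x ∂(𝒢.mixtureMeasure k), x ∈ Set.Icc a b :=
  (withDensity_absolutelyContinuous _ _).ae_le (ae_restrict_mem measurableSet_Icc)

lemma integral_mixtureMeasure (k : 𝒢.Index) (f : (Fin s → ℝ) → ℝ) :
    ∫ x, f x ∂(𝒢.mixtureMeasure k) = ∫ x in Set.Icc a b, f x * 𝒢.prodDensity k x := by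
  rw [mixtureMeasure, integral_withDensity_eq_integral_toReal_smul
    (𝒢.measurable_prodDensity k).ennreal_ofReal
    (Filter.Eventually.of_forall fun x => ENNReal.ofReal_lt_top)]
  refine integral_congr_ae (Filter.Eventually.of_forall fun x => ?_)
  simp only [ENNReal.toReal_ofReal (𝒢.prodDensity_nonneg k x), smul_eq_mul, mul_comm]

/-- By independence of the coordinates the distribution function of a box factorizes, and directions
outside `u` integrate to `1`. -/
lemma integral_prod_indicator_mixtureMeasure (k : 𝒢.Index) (u : Finset (Fin s)) {τ : Fin s → ℝ}
    (hτ : τ ∈ Set.Icc a b) :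
    ∫ x, ∏ j ∈ u, (Set.Iic (τ j)).indicator (1 : ℝ → ℝ) (x j) ∂(𝒢.mixtureMeasure k)
      = ∏ j ∈ u, 𝒢.hatCDF j (k j) (τ j) := by
  classical
  rw [integral_mixtureMeasure]
  have h1 : ∀ x : Fin s → ℝ, (∏ j ∈ u, (Set.Iic (τ j)).indicator (1 : ℝ → ℝ) (x j))
        * 𝒢.prodDensity k x
      = ∏ j, (if j ∈ u then (Set.Iic (τ j)).indicator (1 : ℝ → ℝ) (x j) else 1)
        * 𝒢.hatDensity j (k j) (x j) := by
    intro x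
    rw [Finset.prod_mul_distrib, prodDensity, Finset.prod_ite_mem, Finset.univ_inter]
  simp_rw [h1]
  rw [setIntegral_Icc_prod a b fun j x => (if j ∈ u then (Set.Iic (τ j)).indicator (1 : ℝ → ℝ) x
    else 1) * 𝒢.hatDensity j (k j) x]
  rw [← Finset.prod_subset (Finset.subset_univ u)]
  · refine Finset.prod_congr rfl fun j hj => ?_
    simp only [hj, if_true]
    exact 𝒢.setIntegral_indicator_mul_hatDensity j (k j) ⟨hτ.1 j, hτ.2 j⟩
  · intro j _ hj
    simp only [hj, if_false, one_mul]
    exact 𝒢.setIntegral_hatDensity j (Nat.le_of_lt_succ (k j).2)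

/-- The quadrature error for a single component of the mixture. -/
lemma abs_integral_mixtureMeasure_sub_le (hs : 1 ≤ s) {t : ℕ}
    {C : Fin s → Matrix ℕ ℕ (ZMod 2)} (hC : GeneratesDigitalSequence t C)
    (hCt : ∀ j, IsNonsingularUpperTriangular (C j)) {Q : Fin s → ℕ → ℝ → ℝ}
    (hQ : 𝒢.IsInverseCDF Q) {f : (Fin s → ℝ) → ℝ} (hf : HasMixedPartials a b f)
    {M : Finset (Fin s) → ℝ} (hM : ∀ u, ∀ x ∈ Set.Icc a b, |mixedPartial a b u f x| ≤ M u)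
    (k : 𝒢.Index) {R m : ℕ} (hR : 0 < R) (hRm : R < 2 ^ m) :
    |(∫ x, f x ∂(𝒢.mixtureMeasure k))
        - (∑ n ∈ Finset.range R, f fun j => Q j (k j) (digitalPoint C n j)) / R|
      ≤ ∑ u ∈ Finset.univ.filter (fun u : Finset (Fin s) => u.Nonempty),
        M u * (∏ j ∈ u, (b j - a j)) * (2 ^ t * m ^ (u.card + 1) / R) := by
  have hRpos : (0 : ℝ) < R := by exact_mod_cast hR
  have hk : ∀ j, (k j : ℕ) ≤ 𝒢.K j := fun j => Nat.le_of_lt_succ (k j).2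
  have hy : ∀ n j, digitalPoint C n j ∈ Set.Icc (0 : ℝ) 1 := fun n j =>
    Set.Ico_subset_Icc_self (digitalPoint_mem_Ico hCt n j)
  refine koksma_hlawka 𝒢.left_lt_right hf hM (𝒢.mixtureMeasure k)
    (𝒢.ae_mem_Icc_mixtureMeasure k) hR (fun n j => Q j (k j) (digitalPoint C n j))
    (fun n => ⟨fun j => (hQ j _ (hk j) _ (hy n j)).1.1, fun j => (hQ j _ (hk j) _ (hy n j)).1.2⟩)
    (fun u => 2 ^ t * m ^ (u.card + 1) / R) fun u _ τ hτ => ?_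
  rw [𝒢.integral_prod_indicator_mixtureMeasure k u hτ]
  -- The pulled-back half-line contains `[0, x)` and is contained in `[0, x]`, where `x` is the
  -- value of the distribution function at `τ j`. Whether it contains `x` can depend on the choice
  -- of `Q`, so the discrepancy bound admits both cases.
  have h := abs_discrepancy_le hs hC hCt u (fun j => 𝒢.hatCDF j (k j) (τ j))
    (fun j => 𝒢.hatCDF_nonneg j (hk j) (hτ.1 j)) (fun j => 𝒢.hatCDF_le_one j (hk j) (hτ.2 j))
    (fun j => Q j (k j) ⁻¹' Set.Iic (τ j))
    (fun j y hy0 hy1 hy => by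
      by_contra hcon
      have hlt : τ j < Q j (k j) y := by simpa using hcon
      have := 𝒢.hatCDF_mono j (hk j) hlt.le
      rw [(hQ j _ (hk j) y ⟨hy0, hy1.le⟩).2] at this
      exact this.not_gt hy)
    (fun j y hy hy0 hy1 => by
      have := 𝒢.hatCDF_mono j (hk j) (show Q j (k j) y ≤ τ j from hy)
      rwa [(hQ j _ (hk j) y ⟨hy0, hy1.le⟩).2] at this) m R hRm
  rw [abs_sub_comm, le_div_iff₀ hRpos]
  refine le_trans (le_of_eq ?_) h
  rw [← abs_of_pos hRpos, ← abs_mul, abs_of_pos hRpos, sub_mul, div_mul_cancel₀ _ hRpos.ne',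
    mul_comm (∏ j ∈ u, _)]
  rfl

end TensorGrid

/-! ### Approximation by hat functions -/

lemma boxDiam_le {s : ℕ} {lo hi x y : Fin s → ℝ} (hx : x ∈ Set.Icc lo hi)
    (hy : y ∈ Set.Icc lo hi) : boxDiam x y ≤ boxDiam lo hi := by
  refine Real.sqrt_le_sqrt (Finset.sum_le_sum fun j _ => sq_le_sq' ?_ ?_)
  · linarith [hx.1 j, hx.2 j, hy.1 j, hy.2 j]
  · linarith [hx.1 j, hx.2 j, hy.1 j, hy.2 j]

namespace TensorGrid

variable {s : ℕ} {a b : Fin s → ℝ} (𝒢 : TensorGrid a b)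

lemma point_mem_Icc (i : 𝒢.Index) : 𝒢.point i ∈ Set.Icc a b :=
  ⟨fun j => (𝒢.node_mem_Icc j (Nat.le_of_lt_succ (i j).2)).1,
    fun j => (𝒢.node_mem_Icc j (Nat.le_of_lt_succ (i j).2)).2⟩

/-- The piecewise multilinear interpolant of `π`. -/
noncomputable def interpolant (π : (Fin s → ℝ) → ℝ) (x : Fin s → ℝ) : ℝ :=
  ∑ i, 𝒢.coeff π i * 𝒢.prodDensity i x

/-- The normalizing constants in `coeff` and `prodDensity` cancel, which exhibits the mixture as the
nodal interpolant. -/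
lemma interpolant_eq (π : (Fin s → ℝ) → ℝ) (x : Fin s → ℝ) :
    𝒢.interpolant π x = ∑ i : 𝒢.Index, π (𝒢.point i) * ∏ j, 𝒢.hat j (i j) (x j) := by
  refine Finset.sum_congr rfl fun i _ => ?_
  have hpos : 0 < ∏ j, 𝒢.hatConst j (i j) :=
    Finset.prod_pos fun j _ => 𝒢.hatConst_pos j (Nat.le_of_lt_succ (i j).2)
  simp only [coeff, prodDensity, hatDensity]
  rw [Finset.prod_mul_distrib]
  field_simp

lemma sum_prod_hat {x : Fin s → ℝ} (hx : x ∈ Set.Icc a b) :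
    ∑ i : 𝒢.Index, ∏ j, 𝒢.hat j (i j) (x j) = 1 := by
  have h := Finset.prod_univ_sum (fun j : Fin s => (Finset.univ : Finset (Fin (𝒢.K j + 1))))
    fun j i => 𝒢.hat j i (x j)
  rw [Fintype.piFinset_univ] at h
  rw [← h]
  exact Finset.prod_eq_one fun j _ => 𝒢.sum_hat j ⟨hx.1 j, hx.2 j⟩

lemma lower_lt_upper (k : 𝒢.CellIndex) (j : Fin s) : 𝒢.lower k j < 𝒢.upper k j :=
  𝒢.node_lt j _ (k j).2

lemma cell_subset (k : 𝒢.CellIndex) : Set.Icc (𝒢.lower k) (𝒢.upper k) ⊆ Set.Icc a b :=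
  Set.Icc_subset_Icc (fun j => (𝒢.node_mem_Icc j (k j).2.le).1)
    fun j => (𝒢.node_mem_Icc j (k j).2).2

lemma exists_mem_cell {x : Fin s → ℝ} (hx : x ∈ Set.Icc a b) :
    ∃ k : 𝒢.CellIndex, x ∈ Set.Icc (𝒢.lower k) (𝒢.upper k) := by
  choose i hi hxi using fun j => 𝒢.exists_cell j ⟨hx.1 j, hx.2 j⟩
  exact ⟨fun j => ⟨i j, hi j⟩, fun j => (hxi j).1, fun j => (hxi j).2⟩

lemma point_mem_cell_of_prod_hat_ne_zero {k : 𝒢.CellIndex} {x : Fin s → ℝ}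
    (hx : x ∈ Set.Icc (𝒢.lower k) (𝒢.upper k)) {i : 𝒢.Index}
    (hi : ∏ j, 𝒢.hat j (i j) (x j) ≠ 0) :
    𝒢.point i ∈ Set.Icc (𝒢.lower k) (𝒢.upper k) := by
  have h : ∀ j, (i j : ℕ) = k j ∨ (i j : ℕ) = k j + 1 := by
    intro j
    by_contra hcon
    push Not at hcon
    exact Finset.prod_ne_zero_iff.1 hi j (Finset.mem_univ j)
      (𝒢.hat_eq_zero j (k j).2 (Nat.le_of_lt_succ (i j).2) hcon.1 hcon.2 ⟨hx.1 j, hx.2 j⟩)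
  constructor <;> intro j <;> have hlt := (𝒢.lower_lt_upper k j).le <;>
    simp only [lower, upper, point] at hlt ⊢ <;> rcases h j with h | h <;> rw [h]
  · exact hlt
  · exact hlt

/-- Hölder continuity on the cells. -/
def IsHolderOnCells (g : (Fin s → ℝ) → ℝ) (L : 𝒢.CellIndex → ℝ) (β : ℝ) : Prop :=
  ∀ k : 𝒢.CellIndex, ∀ x ∈ Set.Icc (𝒢.lower k) (𝒢.upper k),
    ∀ y ∈ Set.Icc (𝒢.lower k) (𝒢.upper k), |g x - g y| ≤ L k * boxDiam x y ^ β

variable {𝒢}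

/-- The Hölder bound is tested at two opposite vertices, whose distance is positive because `s ≥ 1`.
-/
lemma IsHolderOnCells.const_nonneg (hs : 1 ≤ s) {g : (Fin s → ℝ) → ℝ} {L : 𝒢.CellIndex → ℝ}
    {β : ℝ} (h : 𝒢.IsHolderOnCells g L β) (k : 𝒢.CellIndex) : 0 ≤ L k := by
  have hle : 𝒢.lower k ≤ 𝒢.upper k := fun j => (𝒢.lower_lt_upper k j).le
  have h1 := (abs_nonneg _).trans (h k _ ⟨le_rfl, hle⟩ _ ⟨hle, le_rfl⟩)
  have h2 : 0 < boxDiam (𝒢.lower k) (𝒢.upper k) := by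
    refine Real.sqrt_pos.2 (Finset.sum_pos (fun j _ => ?_) ⟨⟨0, hs⟩, Finset.mem_univ _⟩)
    have := 𝒢.lower_lt_upper k j
    exact pow_pos (sub_pos.2 this) 2
  exact nonneg_of_mul_nonneg_left h1 (Real.rpow_pos_of_pos h2 β)

/-- At a point of the cell only hats of vertices of that cell are nonzero, and they sum to `1`. The
error is therefore a convex combination of differences bounded by the Hölder condition. -/
lemma IsHolderOnCells.abs_sub_interpolant_le (hs : 1 ≤ s) {π : (Fin s → ℝ) → ℝ} {z : ℝ}
    {L : 𝒢.CellIndex → ℝ} {β : ℝ} (hβ : 0 < β) (h : 𝒢.IsHolderOnCells (fun x => π x / z) L β)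
    (k : 𝒢.CellIndex) {x : Fin s → ℝ} (hx : x ∈ Set.Icc (𝒢.lower k) (𝒢.upper k)) :
    |π x / z - 𝒢.interpolant π x / z| ≤ L k * 𝒢.cellDiam k ^ β := by
  have hH : ∀ i : 𝒢.Index, 0 ≤ ∏ j, 𝒢.hat j (i j) (x j) := fun i =>
    Finset.prod_nonneg fun j _ => 𝒢.hat_nonneg j (Nat.le_of_lt_succ (i j).2) _
  have h1 := 𝒢.sum_prod_hat (𝒢.cell_subset k hx)
  have h2 : π x / z - 𝒢.interpolant π x / z
      = ∑ i : 𝒢.Index, (π x / z - π (𝒢.point i) / z) * ∏ j, 𝒢.hat j (i j) (x j) := by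
    simp_rw [sub_mul]
    rw [Finset.sum_sub_distrib, ← Finset.mul_sum, h1, mul_one, interpolant_eq, Finset.sum_div]
    congr 1
    refine Finset.sum_congr rfl fun i _ => ?_
    ring
  have h3 : L k * 𝒢.cellDiam k ^ β
      = ∑ i : 𝒢.Index, L k * 𝒢.cellDiam k ^ β * ∏ j, 𝒢.hat j (i j) (x j) := by
    rw [← Finset.mul_sum, h1, mul_one]
  rw [h2, h3]
  refine (Finset.abs_sum_le_sum_abs _ _).trans (Finset.sum_le_sum fun i _ => ?_)
  rw [abs_mul, abs_of_nonneg (hH i)]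
  by_cases hi : ∏ j, 𝒢.hat j (i j) (x j) = 0
  · simp [hi]
  · refine mul_le_mul_of_nonneg_right ?_ (hH i)
    have hp := 𝒢.point_mem_cell_of_prod_hat_ne_zero hx hi
    refine (h k x hx _ hp).trans (mul_le_mul_of_nonneg_left ?_ (h.const_nonneg hs k))
    exact Real.rpow_le_rpow (Real.sqrt_nonneg _) (boxDiam_le hx hp) hβ.le

variable (𝒢)

lemma coeff_nonneg {π : (Fin s → ℝ) → ℝ} (hπ : ∀ x ∈ Set.Icc a b, 0 ≤ π x) (i : 𝒢.Index) :
    0 ≤ 𝒢.coeff π i :=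
  mul_nonneg (inv_nonneg.2 (Finset.prod_nonneg fun j _ =>
    (𝒢.hatConst_pos j (Nat.le_of_lt_succ (i j).2)).le)) (hπ _ (𝒢.point_mem_Icc i))

lemma integrableOn_interpolant (π : (Fin s → ℝ) → ℝ) :
    IntegrableOn (𝒢.interpolant π) (Set.Icc a b) :=
  integrable_finsetSum _ fun i _ => (𝒢.integrableOn_prodDensity i).const_mul _

lemma setIntegral_interpolant (π : (Fin s → ℝ) → ℝ) :
    ∫ x in Set.Icc a b, 𝒢.interpolant π x = ∑ i, 𝒢.coeff π i := by
  unfold interpolant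
  rw [integral_finsetSum _ fun i _ => (𝒢.integrableOn_prodDensity i).const_mul _]
  refine Finset.sum_congr rfl fun i _ => ?_
  rw [integral_const_mul, 𝒢.setIntegral_prodDensity, mul_one]

lemma interpolant_nonneg {π : (Fin s → ℝ) → ℝ} (hπ : ∀ x ∈ Set.Icc a b, 0 ≤ π x)
    (x : Fin s → ℝ) : 0 ≤ 𝒢.interpolant π x :=
  Finset.sum_nonneg fun i _ => mul_nonneg (𝒢.coeff_nonneg hπ i) (𝒢.prodDensity_nonneg i x)

/-- The closed cells cover the box. Their overlaps do no harm, since nonnegative bounds are summed.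
-/
lemma setIntegral_abs_sub_interpolant_le (hs : 1 ≤ s) {π : (Fin s → ℝ) → ℝ} {z : ℝ}
    (hπint : IntegrableOn π (Set.Icc a b)) {L : 𝒢.CellIndex → ℝ} {β : ℝ} (hβ : 0 < β)
    (h : 𝒢.IsHolderOnCells (fun x => π x / z) L β) :
    ∫ x in Set.Icc a b, |π x / z - 𝒢.interpolant π x / z|
      ≤ ∑ k : 𝒢.CellIndex, 𝒢.cellVol k * L k * 𝒢.cellDiam k ^ β := by
  classical
  have hnn : ∀ k, 0 ≤ L k * 𝒢.cellDiam k ^ β := fun k =>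
    mul_nonneg (h.const_nonneg hs k) (Real.rpow_nonneg (Real.sqrt_nonneg _) _)
  have : IsFiniteMeasure (volume.restrict (Set.Icc a b)) :=
    ⟨by rw [Measure.restrict_apply_univ]; exact isCompact_Icc.measure_lt_top⟩
  have hint : ∀ k : 𝒢.CellIndex, Integrable (fun x =>
      (Set.Icc (𝒢.lower k) (𝒢.upper k)).indicator (fun _ => L k * 𝒢.cellDiam k ^ β) x)
      (volume.restrict (Set.Icc a b)) := fun k =>
    (integrable_const _).indicator measurableSet_Icc
  calc ∫ x in Set.Icc a b, |π x / z - 𝒢.interpolant π x / z|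
      ≤ ∫ x in Set.Icc a b, ∑ k : 𝒢.CellIndex, (Set.Icc (𝒢.lower k) (𝒢.upper k)).indicator
          (fun _ => L k * 𝒢.cellDiam k ^ β) x := by
        refine setIntegral_mono_on
          ((hπint.div_const z).sub ((𝒢.integrableOn_interpolant π).div_const z)).abs
          (integrable_finsetSum _ fun k _ => hint k) measurableSet_Icc fun x hx => ?_
        obtain ⟨k, hk⟩ := 𝒢.exists_mem_cell hx
        refine (h.abs_sub_interpolant_le hs hβ k hk).trans ?_
        have := Finset.single_le_sum (f := fun k : 𝒢.CellIndex =>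
          (Set.Icc (𝒢.lower k) (𝒢.upper k)).indicator (fun _ => L k * 𝒢.cellDiam k ^ β) x)
          (fun k _ => Set.indicator_nonneg (fun _ _ => hnn k) x) (Finset.mem_univ k)
        rwa [Set.indicator_of_mem hk] at this
    _ = ∑ k : 𝒢.CellIndex, 𝒢.cellVol k * L k * 𝒢.cellDiam k ^ β := by
        rw [integral_finsetSum _ fun k _ => hint k]
        refine Finset.sum_congr rfl fun k _ => ?_
        rw [integral_indicator measurableSet_Icc, Measure.restrict_restrict measurableSet_Icc,
          Set.inter_eq_left.2 (𝒢.cell_subset k), setIntegral_const, smul_eq_mul, mul_assoc]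
        congr 1
        rw [measureReal_def, Real.volume_Icc_pi_toReal fun j => (𝒢.lower_lt_upper k j).le]
        rfl

/-- The error of replacing the target density by the normalized interpolant. -/
lemma abs_integral_sub_mixture_le (hs : 1 ≤ s) {π : (Fin s → ℝ) → ℝ} {z : ℝ}
    (hπ : ∀ x ∈ Set.Icc a b, 0 ≤ π x) (hz : z = ∫ x in Set.Icc a b, π x) (hz_pos : 0 < z)
    {L : 𝒢.CellIndex → ℝ} {β : ℝ} (hβ : 0 < β) (h : 𝒢.IsHolderOnCells (fun x => π x / z) L β)
    (hc : 0 < ∑ i, 𝒢.coeff π i) {f : (Fin s → ℝ) → ℝ}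
    (hfm : AEStronglyMeasurable f (volume.restrict (Set.Icc a b))) {F : ℝ} (hF0 : 0 ≤ F)
    (hF : ∀ᵐ x ∂(volume.restrict (Set.Icc a b)), |f x| ≤ F) :
    |(∫ x in Set.Icc a b, f x * (π x / z))
        - ∑ i, 𝒢.coeff π i / (∑ l, 𝒢.coeff π l) * ∫ x, f x ∂(𝒢.mixtureMeasure i)|
      ≤ 2 * F * ∑ k : 𝒢.CellIndex, 𝒢.cellVol k * L k * 𝒢.cellDiam k ^ β := by
  set c := ∑ i, 𝒢.coeff π i with hcdef
  set S := ∑ k : 𝒢.CellIndex, 𝒢.cellVol k * L k * 𝒢.cellDiam k ^ β with hS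
  -- A non-integrable `π` would have integral `0`, against `z > 0`.
  have hπint : IntegrableOn π (Set.Icc a b) := by
    by_contra hcon
    rw [integral_undef hcon] at hz
    exact hz_pos.ne' hz
  have hπint' : Integrable (fun x => π x / z) (volume.restrict (Set.Icc a b)) :=
    hπint.div_const z
  have hp := 𝒢.integrableOn_interpolant π
  have hp' : Integrable (fun x => 𝒢.interpolant π x / z) (volume.restrict (Set.Icc a b)) :=
    hp.div_const z
  have hbdd : ∀ {g : (Fin s → ℝ) → ℝ}, Integrable g (volume.restrict (Set.Icc a b)) →
      Integrable (fun x => f x * g x) (volume.restrict (Set.Icc a b)) := fun hg =>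
    hg.bdd_mul hfm hF
  have hA := 𝒢.setIntegral_abs_sub_interpolant_le hs hπint hβ h
  rw [← hS] at hA
  have hmix : ∑ i, 𝒢.coeff π i / c * ∫ x, f x ∂(𝒢.mixtureMeasure i)
      = 1 / c * ∫ x in Set.Icc a b, f x * 𝒢.interpolant π x := by
    have h1 : ∀ x, f x * 𝒢.interpolant π x
        = ∑ i, 𝒢.coeff π i * (f x * 𝒢.prodDensity i x) := fun x => by
      rw [interpolant, Finset.mul_sum]
      refine Finset.sum_congr rfl fun i _ => ?_
      ring
    simp_rw [h1]
    rw [integral_finsetSum _ fun i _ => (hbdd (𝒢.integrableOn_prodDensity i)).const_mul _,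
      Finset.mul_sum]
    refine Finset.sum_congr rfl fun i _ => ?_
    rw [integral_const_mul, 𝒢.integral_mixtureMeasure]
    ring
  -- After evaluation of the two integrals this reads `|1 - c / z| ≤ S`: the normalizing constant
  -- inherits the approximation error.
  have hdiff : |∫ x in Set.Icc a b, (π x / z - 𝒢.interpolant π x / z)| ≤ S :=
    (abs_integral_le_integral_abs).trans hA
  rw [integral_sub hπint' hp', integral_div, integral_div, ← hz, 𝒢.setIntegral_interpolant,
    ← hcdef, div_self hz_pos.ne'] at hdiff
  have h1 : |∫ x in Set.Icc a b, f x * (π x / z - 𝒢.interpolant π x / z)| ≤ F * S := by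
    refine (abs_integral_le_integral_abs).trans ?_
    calc ∫ x in Set.Icc a b, |f x * (π x / z - 𝒢.interpolant π x / z)|
        ≤ ∫ x in Set.Icc a b, F * |π x / z - 𝒢.interpolant π x / z| := by
          refine integral_mono_ae (hbdd (hπint'.sub hp')).abs
            ((hπint'.sub hp').abs.const_mul F) ?_
          filter_upwards [hF] with x hx
          rw [abs_mul]
          exact mul_le_mul_of_nonneg_right hx (abs_nonneg _)
      _ ≤ F * S := by
          rw [integral_const_mul]
          exact mul_le_mul_of_nonneg_left hA hF0
  have h2 : |∫ x in Set.Icc a b, f x * 𝒢.interpolant π x| ≤ F * c := by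
    refine (abs_integral_le_integral_abs).trans ?_
    calc ∫ x in Set.Icc a b, |f x * 𝒢.interpolant π x|
        ≤ ∫ x in Set.Icc a b, F * 𝒢.interpolant π x := by
          refine integral_mono_ae (hbdd hp).abs (hp.const_mul F) ?_
          filter_upwards [hF] with x hx
          rw [abs_mul, abs_of_nonneg (𝒢.interpolant_nonneg hπ x)]
          exact mul_le_mul_of_nonneg_right hx (𝒢.interpolant_nonneg hπ x)
      _ = F * c := by rw [integral_const_mul, 𝒢.setIntegral_interpolant]
  -- The first summand is the pointwise approximation error, the second the change of normalization;
  -- each is at most `F * S`.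
  have h3 : (∫ x in Set.Icc a b, f x * (π x / z))
        - 1 / c * ∫ x in Set.Icc a b, f x * 𝒢.interpolant π x
      = (∫ x in Set.Icc a b, f x * (π x / z - 𝒢.interpolant π x / z))
        + (1 / z - 1 / c) * ∫ x in Set.Icc a b, f x * 𝒢.interpolant π x := by
    have : ∀ x, f x * (π x / z - 𝒢.interpolant π x / z)
        = f x * (π x / z) - 1 / z * (f x * 𝒢.interpolant π x) := fun x => by ring
    simp_rw [this]
    rw [integral_sub (hbdd hπint') ((hbdd hp).const_mul _), integral_const_mul]
    ring
  have h4 : |1 / z - 1 / c| * (F * c) ≤ F * S := by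
    have : |1 / z - 1 / c| * c = |1 - c / z| := by
      rw [← abs_of_pos hc, ← abs_mul, abs_of_pos hc, abs_sub_comm]
      congr 1
      field_simp
    calc |1 / z - 1 / c| * (F * c) = F * (|1 / z - 1 / c| * c) := by ring
      _ ≤ F * S := by
        rw [this]
        exact mul_le_mul_of_nonneg_left hdiff hF0
  rw [hmix, h3]
  refine (abs_add_le _ _).trans ?_
  rw [abs_mul]
  have := mul_le_mul_of_nonneg_left h2 (abs_nonneg (1 / z - 1 / c))
  linarith

end TensorGrid

/-! ### Quasi-Monte Carlo for mixtures -/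

section Mixture

variable {κ : Type*} [Fintype κ] {c : κ → ℝ} (σ : Fin (Fintype.card κ) ≃ κ) {δ : ℝ} {N : ℕ}

lemma card_mem_truncLevel_set (hc : 0 < ∑ l, c l) (hδ : 0 < δ) :
    1 - δ / N ≤ ∑ v ∈ Finset.univ.filter
      (fun v : Fin (Fintype.card κ) => (v : ℕ) < Fintype.card κ), c (σ v) / ∑ l, c l := by
  rw [Finset.filter_true_of_mem fun v _ => v.2, ← Finset.sum_div, σ.sum_comp, div_self hc.ne']
  have : 0 ≤ δ / N := by positivity
  linarith

lemma truncLevel_le_card (hc : 0 < ∑ l, c l) (hδ : 0 < δ) :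
    truncLevel c σ δ N ≤ Fintype.card κ :=
  Nat.sInf_le (card_mem_truncLevel_set σ hc hδ)

lemma one_sub_le_sum_retained (hc : 0 < ∑ l, c l) (hδ : 0 < δ) :
    1 - δ / N ≤ ∑ k ∈ retained c σ δ N, c k / ∑ l, c l := by
  have h := Nat.sInf_mem (s := {r : ℕ | 1 - δ / N ≤ ∑ v ∈ Finset.univ.filter
    (fun v : Fin (Fintype.card κ) => (v : ℕ) < r), c (σ v) / ∑ l, c l})
    ⟨_, card_mem_truncLevel_set σ hc hδ⟩
  refine le_trans h (le_of_eq ?_)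
  refine Finset.sum_equiv σ (fun v => ?_) (fun v _ => rfl)
  simp [retained, truncLevel]

lemma truncLevel_pos (hc : 0 < ∑ l, c l) (hδ : 0 < δ) (hδN : δ < N) :
    1 ≤ truncLevel c σ δ N := by
  by_contra hcon
  have h0 : truncLevel c σ δ N = 0 := by omega
  have h := one_sub_le_sum_retained (N := N) σ hc hδ
  simp only [retained, h0, Nat.not_lt_zero, Finset.filter_false, Finset.sum_empty] at h
  have : δ / N < 1 := (div_lt_one (hδ.trans hδN)).2 hδN
  linarith

/-- Each of the first `r - 1` components is charged `3` and the last one `1`, hence `3 r - 2`. -/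
lemma sum_retained_weights (hc : 0 < ∑ l, c l) (hδ : 0 < δ) (hδN : δ < N) :
    ∑ k ∈ retained c σ δ N, (if (σ.symm k : ℕ) + 1 < truncLevel c σ δ N then (3 : ℝ) else 1)
      = 3 * truncLevel c σ δ N - 2 := by
  have h1 := truncLevel_le_card (N := N) σ hc hδ
  obtain ⟨r, hr⟩ := Nat.exists_eq_add_of_le' (truncLevel_pos (N := N) σ hc hδ hδN)
  rw [retained, Finset.sum_filter, hr]
  rw [hr] at h1
  rw [← σ.sum_comp]
  simp only [Equiv.symm_apply_apply]
  rw [Fin.sum_univ_eq_sum_range (fun i => if i < r + 1 then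
    (if i + 1 < r + 1 then (3 : ℝ) else 1) else 0),
    ← Finset.sum_subset (Finset.range_mono h1) (fun i _ hi => if_neg (by simpa using hi)),
    Finset.sum_range_succ, Finset.sum_congr rfl (g := fun _ => (3 : ℝ)) fun i hi => by
      have := Finset.mem_range.1 hi
      rw [if_pos (by omega), if_pos (by omega)]]
  simp
  ring

/-- The error of the quasi-Monte Carlo method for mixtures in terms of the errors for the
components. -/
lemma abs_mixture_sub_mixtureQMC_le {s : ℕ} (hc0 : ∀ k, 0 ≤ c k) (hc : 0 < ∑ l, c l)
    (hδ : 0 < δ) (hδN : δ < N) (T : κ → (Fin s → ℝ) → (Fin s → ℝ)) (y : ℕ → Fin s → ℝ)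
    (f : (Fin s → ℝ) → ℝ) (I : κ → ℝ) {F W : ℝ} (hF0 : 0 ≤ F) (hW : 0 ≤ W)
    (hI : ∀ k, |I k| ≤ F)
    (hErr : ∀ k, ∀ R : ℕ, 0 < R → R ≤ N →
      |I k - (∑ n ∈ Finset.range R, f (T k (y n))) / R| ≤ W / R) :
    |∑ k, c k / (∑ l, c l) * I k - mixtureQMC c σ δ N T y f|
      ≤ (δ + 3 * (truncLevel c σ δ N : ℝ) - 2) / N * (F + W) := by
  classical
  have hN : (0 : ℝ) < N := hδ.trans hδN
  set A := ∑ l, c l with hA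
  set r := truncLevel c σ δ N with hr
  set p : κ → ℝ := fun k => c k / A with hp
  have hp0 : ∀ k, 0 ≤ p k := fun k => div_nonneg (hc0 k) hc.le
  have hp1 : ∑ k, p k = 1 := by rw [hp, ← Finset.sum_div, ← hA, div_self hc.ne']
  have hfloor : ∀ k, N * c k / A = N * p k := fun k => mul_div_assoc _ _ _
  set avg : κ → ℝ := fun k => (∑ n ∈ Finset.range (sampleSize c σ δ N k), f (T k (y n)))
    / sampleSize c σ δ N k with havg
  have hQ : mixtureQMC c σ δ N T y f = ∑ k ∈ retained c σ δ N, p k * avg k := by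
    rw [mixtureQMC, Finset.mul_sum]
    refine Finset.sum_congr rfl fun k _ => ?_
    simp only [hp, havg]
    ring
  have hsplit : ∑ k, p k * I k - mixtureQMC c σ δ N T y f
      = ∑ k ∈ (retained c σ δ N)ᶜ, p k * I k
        + ∑ k ∈ retained c σ δ N, p k * (I k - avg k) := by
    rw [hQ, ← Finset.sum_compl_add_sum (retained c σ δ N) fun k => p k * I k]
    simp_rw [mul_sub]
    rw [Finset.sum_sub_distrib]
    ring
  -- The dropped weights sum to at most `δ / N` by the choice of the truncation level.
  have h1 : |∑ k ∈ (retained c σ δ N)ᶜ, p k * I k| ≤ δ / N * F := by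
    calc |∑ k ∈ (retained c σ δ N)ᶜ, p k * I k|
        ≤ ∑ k ∈ (retained c σ δ N)ᶜ, p k * F := by
          refine (Finset.abs_sum_le_sum_abs _ _).trans (Finset.sum_le_sum fun k _ => ?_)
          rw [abs_mul, abs_of_nonneg (hp0 k)]
          exact mul_le_mul_of_nonneg_left (hI k) (hp0 k)
      _ ≤ δ / N * F := by
          rw [← Finset.sum_mul]
          refine mul_le_mul_of_nonneg_right ?_ hF0
          have h2 := one_sub_le_sum_retained (N := N) σ hc hδ
          have h3 := Finset.sum_compl_add_sum (retained c σ δ N) p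
          rw [hp1] at h3
          have h4 : 1 - δ / N ≤ ∑ k ∈ retained c σ δ N, p k := h2
          linarith
  have h2 : ∀ k ∈ retained c σ δ N, |p k * (I k - avg k)|
      ≤ (F + W) / N * (if (σ.symm k : ℕ) + 1 < r then (3 : ℝ) else 1) := by
    intro k hk
    rw [abs_mul, abs_of_nonneg (hp0 k)]
    have hle1 : p k ≤ 1 := hp1 ▸ Finset.single_le_sum (fun i _ => hp0 i) (Finset.mem_univ k)
    split_ifs with hlt
    · have hss : sampleSize c σ δ N k = ⌊N * p k⌋₊ := by
        rw [sampleSize, if_pos hlt, hfloor]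
      have hub : N * p k < sampleSize c σ δ N k + 1 := hss ▸ Nat.lt_floor_add_one _
      -- If rounding down leaves no point, the weight is below `1 / N` and losing the whole
      -- component costs at most `F / N`.
      rcases Nat.eq_zero_or_pos (sampleSize c σ δ N k) with h0 | hpos
      · have : avg k = 0 := by simp [havg, h0]
        rw [this, sub_zero]
        rw [h0] at hub
        have hpk : p k ≤ 1 / N := by
          rw [le_div_iff₀ hN]
          push_cast at hub
          linarith
        calc p k * |I k| ≤ 1 / N * F := mul_le_mul hpk (hI k) (abs_nonneg _) (by positivity)
          _ ≤ (F + W) / N * 3 := by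
            rw [one_div_mul_eq_div, div_mul_eq_mul_div]
            gcongr
            linarith
      · have hR : sampleSize c σ δ N k ≤ N := by
          rw [hss]
          refine Nat.floor_le_of_le ?_
          nlinarith [hp0 k]
        have hRpos : (1 : ℝ) ≤ sampleSize c σ δ N k := by exact_mod_cast hpos
        -- From `N p < n + 1 ≤ 2 n`, where `n ≥ 1` is the sample size.
        have hpk : p k ≤ 2 * sampleSize c σ δ N k / N := by
          rw [le_div_iff₀ hN]
          linarith
        calc p k * |I k - avg k|
            ≤ 2 * sampleSize c σ δ N k / N * (W / sampleSize c σ δ N k) :=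
              mul_le_mul hpk (hErr k _ hpos hR) (abs_nonneg _) (by positivity)
          _ = 2 * W / N := by field_simp
          _ ≤ (F + W) / N * 3 := by
            rw [div_mul_eq_mul_div]
            exact div_le_div_of_nonneg_right (by linarith) hN.le
    · set J := Finset.univ.filter fun i => (σ.symm i : ℕ) + 1 < truncLevel c σ δ N with hJ
      have hss : sampleSize c σ δ N k = N - ∑ i ∈ J, ⌊N * p i⌋₊ := by
        rw [sampleSize, if_neg hlt]
        exact congrArg _ (Finset.sum_congr rfl fun i _ => by rw [← hfloor])
      have hkJ : k ∉ J := by simpa [hJ] using hlt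
      have hJsum : ∑ i ∈ J, p i + p k ≤ 1 := by
        rw [← hp1, add_comm, ← Finset.sum_insert hkJ]
        exact Finset.sum_le_sum_of_subset_of_nonneg (Finset.subset_univ _) fun i _ _ => hp0 i
      have hJfl : ((∑ i ∈ J, ⌊N * p i⌋₊ : ℕ) : ℝ) ≤ N * ∑ i ∈ J, p i := by
        rw [Finset.mul_sum]
        push_cast
        exact Finset.sum_le_sum fun i _ => Nat.floor_le (mul_nonneg hN.le (hp0 i))
      have hJN : ∑ i ∈ J, ⌊N * p i⌋₊ ≤ N := by
        have : ((∑ i ∈ J, ⌊N * p i⌋₊ : ℕ) : ℝ) ≤ N := hJfl.trans (by nlinarith [hp0 k])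
        exact_mod_cast this
      -- The last component collects what the others lose by rounding, so it has at least its fair
      -- share of points. If this share is no point at all, its weight is zero.
      have hub : N * p k ≤ sampleSize c σ δ N k := by
        rw [hss, Nat.cast_sub hJN]
        nlinarith
      rcases Nat.eq_zero_or_pos (sampleSize c σ δ N k) with h0 | hpos
      · rw [h0, Nat.cast_zero] at hub
        have hpk : p k = 0 := le_antisymm (by
          by_contra hcon
          have := mul_pos hN (not_le.1 hcon)
          linarith) (hp0 k)
        rw [hpk, zero_mul]
        positivity
      · have hR : sampleSize c σ δ N k ≤ N := hss ▸ Nat.sub_le _ _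
        have hRpos : (0 : ℝ) < sampleSize c σ δ N k := by exact_mod_cast hpos
        have hpk : p k ≤ sampleSize c σ δ N k / N := by
          rw [le_div_iff₀ hN]
          linarith
        calc p k * |I k - avg k|
            ≤ sampleSize c σ δ N k / N * (W / sampleSize c σ δ N k) :=
              mul_le_mul hpk (hErr k _ hpos hR) (abs_nonneg _) (by positivity)
          _ = W / N := by field_simp
          _ ≤ (F + W) / N * 1 := by
            rw [mul_one]
            gcongr
            linarith
  have h3 : |∑ k ∈ retained c σ δ N, p k * (I k - avg k)| ≤ (F + W) / N * (3 * r - 2) := by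
    refine (Finset.abs_sum_le_sum_abs _ _).trans ((Finset.sum_le_sum h2).trans (le_of_eq ?_))
    rw [← Finset.mul_sum, sum_retained_weights σ hc hδ hδN]
  rw [hsplit]
  refine (abs_add_le _ _).trans ((add_le_add h1 h3).trans ?_)
  have h4 : δ / N * F ≤ δ / N * (F + W) := by gcongr; linarith
  refine (add_le_add_left h4 _).trans (le_of_eq ?_)
  ring

end Mixture

/-! ### Aggregates and Hölder's inequality -/

section LpAgg

variable {ι : Type*} {p q : ℝ≥0∞}

lemma le_lpAgg (hp : 1 ≤ p) {I : Finset ι} (v : ι → ℝ≥0∞) {i : ι} (hi : i ∈ I) :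
    v i ≤ lpAgg p I v := by
  unfold lpAgg
  split_ifs with h
  · exact Finset.le_sup hi
  · have hp0 : 0 < p.toReal := ENNReal.toReal_pos (zero_lt_one.trans_le hp).ne' h
    calc v i = (v i ^ p.toReal) ^ (1 / p.toReal) := by
          rw [← ENNReal.rpow_mul, mul_one_div_cancel hp0.ne', ENNReal.rpow_one]
      _ ≤ _ := ENNReal.rpow_le_rpow
          (Finset.single_le_sum (f := fun i => v i ^ p.toReal) (fun _ _ => zero_le) hi)
          (by positivity)

lemma lpAgg_mono {I J : Finset ι} (hIJ : I ⊆ J) (v : ι → ℝ≥0∞) : lpAgg p I v ≤ lpAgg p J v := by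
  unfold lpAgg
  split_ifs with h
  · exact Finset.sup_mono hIJ
  · exact ENNReal.rpow_le_rpow (Finset.sum_le_sum_of_subset hIJ) (by positivity)

lemma lpAgg_lt_top {I : Finset ι} {v : ι → ℝ≥0∞} (hv : ∀ i ∈ I, v i < ∞) : lpAgg p I v < ∞ := by
  unfold lpAgg
  split_ifs with h
  · exact (Finset.sup_lt_iff ENNReal.zero_lt_top).2 hv
  · refine ENNReal.rpow_lt_top_of_nonneg (by positivity) (ENNReal.sum_lt_top.2 fun i hi => ?_).ne
    exact ENNReal.rpow_lt_top_of_nonneg ENNReal.toReal_nonneg (hv i hi).ne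

lemma lpAgg_one (I : Finset ι) (v : ι → ℝ≥0∞) : lpAgg 1 I v = ∑ i ∈ I, v i := by
  simp [lpAgg]

lemma lpAgg_top (I : Finset ι) (v : ι → ℝ≥0∞) : lpAgg ∞ I v = I.sup v := by
  simp [lpAgg]

lemma sum_mul_le_lpAgg_mul_lpAgg (hp : 1 ≤ p) (hq : 1 ≤ q) (hpq : 1 / p + 1 / q = 1)
    (I : Finset ι) (v w : ι → ℝ≥0∞) :
    ∑ i ∈ I, v i * w i ≤ lpAgg p I v * lpAgg q I w := by
  by_cases hpt : p = ∞
  · subst hpt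
    have : q = 1 := by simpa using hpq
    subst this
    rw [lpAgg_top, lpAgg_one, Finset.mul_sum]
    exact Finset.sum_le_sum fun i hi => mul_le_mul_left (Finset.le_sup hi) _
  by_cases hqt : q = ∞
  · subst hqt
    have : p = 1 := by simpa using hpq
    subst this
    rw [lpAgg_top, lpAgg_one, Finset.sum_mul]
    exact Finset.sum_le_sum fun i hi => mul_le_mul_right (Finset.le_sup hi) _
  have hp0 : p ≠ 0 := (zero_lt_one.trans_le hp).ne'
  have hq0 : q ≠ 0 := (zero_lt_one.trans_le hq).ne'
  have hinv : p.toReal⁻¹ + q.toReal⁻¹ = 1 := by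
    rw [one_div, one_div] at hpq
    have := congrArg ENNReal.toReal hpq
    rwa [ENNReal.toReal_add (ENNReal.inv_ne_top.2 hp0) (ENNReal.inv_ne_top.2 hq0),
      ENNReal.toReal_inv, ENNReal.toReal_inv, ENNReal.toReal_one] at this
  have hppos : 0 < p.toReal := ENNReal.toReal_pos hp0 hpt
  have hqpos : 0 < q.toReal := ENNReal.toReal_pos hq0 hqt
  have hconj : p.toReal.HolderConjugate q.toReal := by
    refine Real.holderConjugate_iff.2 ⟨?_, hinv⟩
    have : 0 < q.toReal⁻¹ := inv_pos.2 hqpos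
    exact (inv_lt_one₀ hppos).1 (by linarith)
  have := ENNReal.inner_le_Lp_mul_Lq I v w hconj
  simpa only [lpAgg, hpt, hqt, if_false] using this

end LpAgg

/-! ### The weighted norm -/

section WeightedNorm

variable {s : ℕ} {p q : ℝ≥0∞} {γ : Finset (Fin s) → ℝ} {a b : Fin s → ℝ}
  {f : (Fin s → ℝ) → ℝ}

/-- The supremum of a mixed partial derivative over the box. -/
noncomputable def supMixedPartial (a b : Fin s → ℝ) (f : (Fin s → ℝ) → ℝ)
    (u : Finset (Fin s)) : ℝ≥0∞ :=
  ⨆ x ∈ Set.Icc a b, ENNReal.ofReal |mixedPartial a b u f x|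

lemma ofReal_mul_supMixedPartial_le (hp : 1 ≤ p) (u : Finset (Fin s)) :
    ENNReal.ofReal (1 / γ u) * supMixedPartial a b f u ≤ weightedNorm p γ a b f :=
  le_lpAgg hp (fun u => ENNReal.ofReal (1 / γ u) * supMixedPartial a b f u) (Finset.mem_univ u)

lemma supMixedPartial_lt_top (hp : 1 ≤ p) (hγ : ∀ u, 0 < γ u)
    (hf : weightedNorm p γ a b f < ∞) (u : Finset (Fin s)) : supMixedPartial a b f u < ∞ := by
  have h := (ofReal_mul_supMixedPartial_le hp u).trans_lt hf
  have hpos : 0 < ENNReal.ofReal (1 / γ u) := ENNReal.ofReal_pos.2 (one_div_pos.2 (hγ u))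
  by_contra hcon
  rw [not_lt_top_iff] at hcon
  rw [hcon, ENNReal.mul_top hpos.ne'] at h
  exact lt_irrefl _ h

lemma abs_mixedPartial_le (hp : 1 ≤ p) (hγ : ∀ u, 0 < γ u) (hf : weightedNorm p γ a b f < ∞)
    (u : Finset (Fin s)) {x : Fin s → ℝ} (hx : x ∈ Set.Icc a b) :
    |mixedPartial a b u f x| ≤ (supMixedPartial a b f u).toReal := by
  rw [← ENNReal.ofReal_le_iff_le_toReal (supMixedPartial_lt_top hp hγ hf u).ne]
  exact le_iSup₂ (f := fun x (_ : x ∈ Set.Icc a b) => ENNReal.ofReal |mixedPartial a b u f x|) x hx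

lemma abs_le_weightedNorm (hp : 1 ≤ p) (hγ : ∀ u, 0 < γ u) (hγ_empty : γ ∅ ≤ 1)
    (hf : weightedNorm p γ a b f < ∞) {x : Fin s → ℝ} (hx : x ∈ Set.Icc a b) :
    |f x| ≤ (weightedNorm p γ a b f).toReal := by
  have h1 := abs_mixedPartial_le hp hγ hf ∅ hx
  rw [mixedPartial_empty] at h1
  refine h1.trans (ENNReal.toReal_mono hf.ne (le_trans ?_ (ofReal_mul_supMixedPartial_le hp ∅)))
  refine le_mul_of_one_le_left' ?_
  rw [ENNReal.one_le_ofReal]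
  exact (one_le_div (hγ ∅)).2 hγ_empty

/-- Inserting `γ u / γ u` prepares Hölder's inequality. The norm also contains the term of the empty
set, so passing from nonempty to all subsets only enlarges the bound. -/
lemma sum_supMixedPartial_mul_le (hp : 1 ≤ p) (hq : 1 ≤ q) (hpq : 1 / p + 1 / q = 1)
    (hγ : ∀ u, 0 < γ u) (hf : weightedNorm p γ a b f < ∞) (hab : ∀ j, a j ≤ b j) {N : ℕ} :
    ∑ u ∈ Finset.univ.filter (fun u : Finset (Fin s) => u.Nonempty),
        (supMixedPartial a b f u).toReal * ∏ j ∈ u, (3 * (b j - a j) * Real.log N)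
      ≤ (weightedNorm p γ a b f).toReal * gFactor γ q a b N := by
  set J := Finset.univ.filter (fun u : Finset (Fin s) => u.Nonempty) with hJ
  set v : Finset (Fin s) → ℝ≥0∞ := fun u =>
    ENNReal.ofReal (1 / γ u) * supMixedPartial a b f u with hv
  set w : Finset (Fin s) → ℝ≥0∞ := fun u =>
    ENNReal.ofReal (γ u * ∏ j ∈ u, (3 * (b j - a j) * Real.log N)) with hw
  have hprod : ∀ u : Finset (Fin s), 0 ≤ ∏ j ∈ u, (3 * (b j - a j) * Real.log N) := fun u =>
    Finset.prod_nonneg fun j _ => mul_nonneg (mul_nonneg (by norm_num) (sub_nonneg.2 (hab j)))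
      (Real.log_natCast_nonneg N)
  have hvt : ∀ u, v u < ∞ := fun u => ENNReal.mul_lt_top ENNReal.ofReal_lt_top
    (supMixedPartial_lt_top hp hγ hf u)
  have hwt : ∀ u, w u < ∞ := fun u => ENNReal.ofReal_lt_top
  have h1 : ∑ u ∈ J, v u * w u ≤ weightedNorm p γ a b f * lpAgg q J w :=
    (sum_mul_le_lpAgg_mul_lpAgg hp hq hpq J v w).trans
      (mul_le_mul_left (lpAgg_mono (Finset.subset_univ J) v) _)
  have h2 := ENNReal.toReal_mono
    (ENNReal.mul_lt_top hf (lpAgg_lt_top (p := q) (I := J) fun u _ => hwt u)).ne h1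
  rw [ENNReal.toReal_mul,
    ENNReal.toReal_sum fun u _ => (ENNReal.mul_lt_top (hvt u) (hwt u)).ne] at h2
  refine le_trans (le_of_eq ?_) h2
  refine Finset.sum_congr rfl fun u _ => ?_
  have hg := hγ u
  rw [hv, hw, ENNReal.toReal_mul, ENNReal.toReal_mul,
    ENNReal.toReal_ofReal (one_div_pos.2 hg).le,
    ENNReal.toReal_ofReal (mul_nonneg hg.le (hprod u))]
  generalize ∏ j ∈ u, (3 * (b j - a j) * Real.log N) = P
  field_simp

end WeightedNorm

/-- If `N` has `m + 1` binary digits, then `m log 2 ≤ log N`. The second bound uses `m + 1 ≤ 2 m`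
and `2 / log 2 < 3`; the first has room to spare, as `1 / log 2` would already do in place of `5`.
-/
lemma size_le_log {N : ℕ} (hN : 2 ≤ N) :
    (N.size : ℝ) ≤ 5 * Real.log (2 * N) ∧ (N.size : ℝ) ≤ 3 * Real.log N := by
  have hN0 : (0 : ℝ) < N := by positivity
  have hlog2 := Real.log_two_gt_d9
  have hsize : 2 ≤ N.size := Nat.lt_size.2 (by simpa using hN)
  obtain ⟨m, hm⟩ := Nat.exists_eq_add_of_le' (show 1 ≤ N.size by omega)
  have hm1 : (1 : ℝ) ≤ m := by exact_mod_cast (by omega : 1 ≤ m)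
  have hpow : (2 : ℝ) ^ m ≤ N := by exact_mod_cast Nat.lt_size.1 (show m < N.size by omega)
  have hlog : m * Real.log 2 ≤ Real.log N := by
    rw [← Real.log_pow]
    exact Real.log_le_log (by positivity) hpow
  have h2N : Real.log (2 * N) = Real.log 2 + Real.log N :=
    Real.log_mul two_ne_zero hN0.ne'
  have hcast : (N.size : ℝ) = m + 1 := by rw [hm]; push_cast; ring
  rw [hcast, h2N]
  have h3 : (m : ℝ) * 0.69 ≤ m * Real.log 2 :=
    mul_le_mul_of_nonneg_left (by linarith) (by linarith)
  constructor <;> linarith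

end HatQMC

/-! ### The total error -/

open HatQMC

theorem theorem3 {s : ℕ} (hs : 1 ≤ s)
    (p q : ℝ≥0∞) (hp : 1 ≤ p) (hq : 1 ≤ q) (hpq : 1 / p + 1 / q = 1)
    (γ : Finset (Fin s) → ℝ) (hγ : ∀ u, 0 < γ u) (hγ_empty : γ ∅ ≤ 1)
    (a b : Fin s → ℝ) (𝒢 : HatQMC.TensorGrid a b)
    (π : (Fin s → ℝ) → ℝ) (z : ℝ)
    (hπ_nonneg : ∀ x ∈ Set.Icc a b, 0 ≤ π x)
    (hπ_bdd : BddAbove (π '' Set.Icc a b))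
    (hz : z = ∫ x in Set.Icc a b, π x) (hz_pos : 0 < z)
    (β : ℝ) (hβ_pos : 0 < β) (hβ_le : β ≤ 1)
    (L : 𝒢.CellIndex → ℝ)
    (hHolder : ∀ k : 𝒢.CellIndex, ∀ x ∈ Set.Icc (𝒢.lower k) (𝒢.upper k),
      ∀ y ∈ Set.Icc (𝒢.lower k) (𝒢.upper k),
        |π x / z - π y / z| ≤ L k * HatQMC.boxDiam x y ^ β)
    (hc_pos : 0 < ∑ k, 𝒢.coeff π k)
    (f : (Fin s → ℝ) → ℝ) (hf : HatQMC.HasMixedPartials a b f)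
    (hf_norm : HatQMC.weightedNorm p γ a b f < ∞)
    (t : ℕ) (C : Fin s → Matrix ℕ ℕ (ZMod 2))
    (hC : HatQMC.GeneratesDigitalSequence t C)
    (hC_tri : ∀ j, HatQMC.IsNonsingularUpperTriangular (C j))
    (Q : Fin s → ℕ → ℝ → ℝ) (hQ : 𝒢.IsInverseCDF Q)
    (N : ℕ) (hN : 2 ≤ N) (δ : ℝ) (hδ_pos : 0 < δ) (hδ_lt : δ < N)
    (σ : Fin (Fintype.card 𝒢.Index) ≃ 𝒢.Index)
    (hσ : Antitone fun v => 𝒢.coeff π (σ v)) :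
    |(∫ x in Set.Icc a b, f x * (π x / z))
        - 𝒢.hatQMC π σ δ N Q (HatQMC.digitalPoint C) f|
      ≤ 2 * (eLpNorm f ∞ (volume.restrict (Set.Icc a b))).toReal
            * ∑ k : 𝒢.CellIndex, 𝒢.cellVol k * L k * 𝒢.cellDiam k ^ β
        + (HatQMC.weightedNorm p γ a b f).toReal
            * ((δ + 3 * (HatQMC.truncLevel (𝒢.coeff π) σ δ N : ℝ) - 2) / N)
            * (1 + 5 * 2 ^ t * Real.log (2 * N) * HatQMC.gFactor γ q a b N) := by
  set F := (weightedNorm p γ a b f).toReal with hF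
  set A := 5 * 2 ^ t * Real.log (2 * N) with hA
  set G := gFactor γ q a b N with hG
  have hF0 : 0 ≤ F := ENNReal.toReal_nonneg
  have hG0 : 0 ≤ G := ENNReal.toReal_nonneg
  have hN0 : (0 : ℝ) < N := by positivity
  have hlog : 0 ≤ Real.log (2 * N) := Real.log_nonneg (by
    have : (2 : ℝ) ≤ N := by exact_mod_cast hN
    linarith)
  have hA0 : 0 ≤ A := by positivity
  have hM : ∀ u, ∀ x ∈ Set.Icc a b,
      |mixedPartial a b u f x| ≤ (supMixedPartial a b f u).toReal := fun u x hx =>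
    abs_mixedPartial_le hp hγ hf_norm u hx
  have hfF : ∀ x ∈ Set.Icc a b, |f x| ≤ F := fun x hx =>
    abs_le_weightedNorm hp hγ hγ_empty hf_norm hx
  have hfm : AEStronglyMeasurable f (volume.restrict (Set.Icc a b)) :=
    (hf.continuousOn fun j => hM {j}).aestronglyMeasurable measurableSet_Icc
  have hfae : ∀ᵐ x ∂(volume.restrict (Set.Icc a b)),
      |f x| ≤ (eLpNorm f ∞ (volume.restrict (Set.Icc a b))).toReal := by
    -- `toReal` sends `∞` to `0`, so the essential supremum must be shown finite before it can bound
    -- `f`.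
    have htop : eLpNorm f ∞ (volume.restrict (Set.Icc a b)) < ∞ := by
      rw [eLpNorm_exponent_top]
      refine eLpNormEssSup_lt_top_of_ae_bound (C := F) ?_
      filter_upwards [ae_restrict_mem measurableSet_Icc] with x hx
      exact hfF x hx
    rw [eLpNorm_exponent_top] at htop ⊢
    filter_upwards [ae_le_eLpNormEssSup (f := f) (μ := volume.restrict (Set.Icc a b))] with x hx
    have := ENNReal.toReal_mono htop.ne hx
    simpa using this
  have happrox := 𝒢.abs_integral_sub_mixture_le hs hπ_nonneg hz hz_pos hβ_pos hHolder hc_pos hfm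
    ENNReal.toReal_nonneg hfae
  -- The numerator `F * (A * G)` must not depend on `k` or `R`. All sample sizes are at most `N < 2
  -- ^ N.size`, so one number of binary digits serves for all of them.
  have hErr : ∀ k : 𝒢.Index, ∀ R : ℕ, 0 < R → R ≤ N →
      |(∫ x, f x ∂(𝒢.mixtureMeasure k))
        - (∑ n ∈ Finset.range R, f fun j => Q j (k j) (digitalPoint C n j)) / R|
        ≤ F * (A * G) / R := by
    intro k R hR hRN
    have hR0 : (0 : ℝ) < R := by exact_mod_cast hR
    refine (𝒢.abs_integral_mixtureMeasure_sub_le hs hC hC_tri hQ hf hM k hR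
      (hRN.trans_lt (Nat.lt_size_self N))).trans ?_
    obtain ⟨hm1, hm2⟩ := size_le_log hN
    have hsum := sum_supMixedPartial_mul_le (N := N) hp hq hpq hγ hf_norm
      fun j => (𝒢.left_lt_right j).le
    calc ∑ u ∈ Finset.univ.filter (fun u : Finset (Fin s) => u.Nonempty),
          (supMixedPartial a b f u).toReal * (∏ j ∈ u, (b j - a j))
            * (2 ^ t * (N.size : ℝ) ^ (u.card + 1) / R)
        ≤ ∑ u ∈ Finset.univ.filter (fun u : Finset (Fin s) => u.Nonempty),
          A / R * ((supMixedPartial a b f u).toReal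
            * ∏ j ∈ u, (3 * (b j - a j) * Real.log N)) := by
          refine Finset.sum_le_sum fun u _ => ?_
          have h1 : ∏ j ∈ u, (3 * (b j - a j) * Real.log N)
              = (∏ j ∈ u, (b j - a j)) * (3 * Real.log N) ^ u.card := by
            rw [← Finset.prod_const, ← Finset.prod_mul_distrib]
            exact Finset.prod_congr rfl fun j _ => by ring
          have h2 : 0 ≤ ∏ j ∈ u, (b j - a j) :=
            Finset.prod_nonneg fun j _ => (sub_pos.2 (𝒢.left_lt_right j)).le
          -- Of the `|u| + 1` factors, one per direction goes into `G` as `3 log N`; the extra one,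
          -- due to the splitting into blocks, becomes `5 log (2 N)`.
          have h3 : 2 ^ t * (N.size : ℝ) ^ (u.card + 1) ≤ A * (3 * Real.log N) ^ u.card := by
            have : (N.size : ℝ) ^ u.card * N.size
                ≤ (3 * Real.log N) ^ u.card * (5 * Real.log (2 * N)) := by gcongr
            calc 2 ^ t * (N.size : ℝ) ^ (u.card + 1)
                = 2 ^ t * ((N.size : ℝ) ^ u.card * N.size) := by rw [pow_succ]
              _ ≤ 2 ^ t * ((3 * Real.log N) ^ u.card * (5 * Real.log (2 * N))) := by gcongr
              _ = A * (3 * Real.log N) ^ u.card := by rw [hA]; ring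
          rw [h1]
          calc (supMixedPartial a b f u).toReal * (∏ j ∈ u, (b j - a j))
                * (2 ^ t * (N.size : ℝ) ^ (u.card + 1) / R)
              ≤ (supMixedPartial a b f u).toReal * (∏ j ∈ u, (b j - a j))
                * (A * (3 * Real.log N) ^ u.card / R) := by
                refine mul_le_mul_of_nonneg_left ?_ (mul_nonneg ENNReal.toReal_nonneg h2)
                exact div_le_div_of_nonneg_right h3 hR0.le
            _ = _ := by ring
      _ ≤ F * (A * G) / R := by
          rw [← Finset.mul_sum]
          calc A / R * _ ≤ A / R * (F * G) := mul_le_mul_of_nonneg_left hsum (by positivity)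
            _ = F * (A * G) / R := by ring
  have hI : ∀ k : 𝒢.Index, |∫ x, f x ∂(𝒢.mixtureMeasure k)| ≤ F := fun k => by
    have := norm_integral_le_of_norm_le_const (μ := 𝒢.mixtureMeasure k) (f := f) (C := F) (by
      filter_upwards [𝒢.ae_mem_Icc_mixtureMeasure k] with x hx
      exact hfF x hx)
    simpa using this
  have hmix := abs_mixture_sub_mixtureQMC_le σ (N := N) (𝒢.coeff_nonneg hπ_nonneg) hc_pos hδ_pos
    hδ_lt (fun k x j => Q j (k j) (x j)) (digitalPoint C) f
    (fun k => ∫ x, f x ∂(𝒢.mixtureMeasure k)) hF0 (by positivity : 0 ≤ F * (A * G)) hI hErr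
  refine (abs_sub_le _ _ _).trans ((add_le_add happrox hmix).trans (le_of_eq ?_))
  ring
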